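/- Let $\omega:[0,+\infty)\to[0,+\infty)$ be a non-quasianalytic subadditive weight function, i.e. a continuous increasing (non-decreasing) function with $(\alpha)$ $\omega(s+t)\le\omega(s)+\omega(t)$ for $s,t\ge0$; $(\beta)$ $\int_1^{+\infty}\omega(t)t^{-2}\,dt<+\infty$; $(\gamma)$ $\log t=o(\omega(t))$ as $t\to+\infty$; $(\delta)$ $t\mapsto\omega(e^t)$ is convex on $\mathbb R$. Put $\omega(x):=\omega(|x|)$ for vectors $x$ and $\widehat u(\xi)=\int e^{-i\langle x,\xi\rangle}u(x)\,dx$. Let $\mathcal S_\omega(\mathbb R^n)$ be the space of all $u\in\mathcal S(\mathbb R^n)$ such that $$\sup_{x}e^{\lambda\omega(x)}|\partial^\alpha u(x)|<+\infty,\qquad \sup_{\xi}e^{\lambda\omega(\xi)}|\partial^\alpha\widehat u(\xi)|<+\infty\qquad\text{for all }\lambda>0,\ \alpha\in\mathbb N_0^n,$$ with the locally convex topology given by these seminorms, and let $\mathcal S'_\omega(\mathbb R^n)$ be its dual space with the strong topology; $\mathcal S_\omega(\mathbb R^n)$ is embedded in $\mathcal S'_\omega(\mathbb R^n)$ by letting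 $f$ act as $g\mapsto\int f(x)g(x)\,dx$. Let $a\in\mathcal S_\omega(\mathbb R^{2d})$ have compact support, and for $f\in\mathcal S_\omega(\mathbb R^d)$ put $$a(x,D)f(x)=(2\pi)^{-d}\int_{\mathbb R^d}e^{i\langle x,\xi\rangle}a(x,\xi)\widehat f(\xi)\,d\xi .$$ Then $a(x,D)$ maps $\mathcal S_\omega(\mathbb R^d)$ into itself and extends in a unique way to a continuous linear operator $a(x,D):\mathcal S'_\omega(\mathbb R^d)\to\mathcal S'_\omega(\mathbb R^d)$, and this operator is globally $\omega$-regularizing: $a(x,D)u\in\mathcal S_\omega(\mathbb R^d)$ for every $u\in\mathcal S'_\omega(\mathbb R^d)$. -/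

import Mathlib

open MeasureTheory Filter Set Asymptotics
open scoped SchwartzMap InnerProductSpace FourierTransform

noncomputable section

/-- A non-quasianalytic subadditive weight function. Only the values on `[0, ∞)` matter. -/
structure OmegaWeight where
  toFun : ℝ → ℝ
  nonneg : ∀ t, 0 ≤ t → 0 ≤ toFun t
  continuousOn : ContinuousOn toFun (Ici 0)
  monotoneOn : MonotoneOn toFun (Ici 0)
  subadditive : ∀ s t, 0 ≤ s → 0 ≤ t → toFun (s + t) ≤ toFun s + toFun t
  nonquasianalytic : IntegrableOn (fun t => toFun t / t ^ 2) (Ioi 1)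
  log_isLittleO : Real.log =o[atTop] toFun
  convexOn_exp : ConvexOn ℝ univ (fun t => toFun (Real.exp t))

/-- The Fourier transform `f̂(ξ) = ∫ e^{-i⟨x,ξ⟩} f(x) dx`. -/
def omegaFourier {ι : Type*} [Fintype ι] (f : EuclideanSpace ℝ ι → ℂ)
    (ξ : EuclideanSpace ℝ ι) : ℂ :=
  ∫ x, Complex.exp (-(Complex.I * (⟪x, ξ⟫_ℝ : ℂ))) * f x

theorem omegaFourier_eq {ι : Type*} [Fintype ι] (f : EuclideanSpace ℝ ι → ℂ)
    (ξ : EuclideanSpace ℝ ι) : omegaFourier f ξ = 𝓕 f ((2 * Real.pi)⁻¹ • ξ) := by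
  rw [Real.fourier_eq', omegaFourier]
  congr 1
  ext x
  rw [smul_eq_mul, real_inner_smul_right]
  congr 2
  push_cast
  have : (Real.pi : ℂ) ≠ 0 := by exact_mod_cast Real.pi_ne_zero
  field_simp

/-- Rescaling by `(2π)⁻¹` as a linear isomorphism. -/
def omegaRescale (ι : Type*) [Fintype ι] : EuclideanSpace ℝ ι ≃L[ℝ] EuclideanSpace ℝ ι :=
  ContinuousLinearEquiv.smulLeft (Units.mk0 ((2 * Real.pi)⁻¹ : ℝ) (by positivity))

theorem omegaFourier_eq_schwartz {ι : Type*} [Fintype ι] (f : 𝓢(EuclideanSpace ℝ ι, ℂ)) :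
    omegaFourier f =
      SchwartzMap.compCLMOfContinuousLinearEquiv ℂ (omegaRescale ι) (𝓕 f) := by
  ext ξ
  rw [omegaFourier_eq, SchwartzMap.compCLMOfContinuousLinearEquiv_apply, Function.comp_apply,
    SchwartzMap.fourier_coe]
  rfl

/-- The Fourier transform (in the normalization of `omegaFourier`) as a linear map of
Schwartz functions. -/
def schwartzFourier (ι : Type*) [Fintype ι] :
    𝓢(EuclideanSpace ℝ ι, ℂ) →ₗ[ℂ] 𝓢(EuclideanSpace ℝ ι, ℂ) where
  toFun f :=
    { toFun := omegaFourier f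
      smooth' := by rw [omegaFourier_eq_schwartz]; exact SchwartzMap.smooth' _
      decay' := by rw [omegaFourier_eq_schwartz]; exact SchwartzMap.decay' _ }
  map_add' f g := by
    ext ξ
    change omegaFourier (f + g : 𝓢(EuclideanSpace ℝ ι, ℂ)) ξ = omegaFourier f ξ + omegaFourier g ξ
    simp only [omegaFourier_eq_schwartz, FourierTransform.fourier_add, map_add]
    rfl
  map_smul' c f := by
    ext ξ
    change omegaFourier (c • f : 𝓢(EuclideanSpace ℝ ι, ℂ)) ξ = c • omegaFourier f ξ
    simp only [omegaFourier_eq_schwartz, FourierTransform.fourier_smul, map_smul]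
    rfl

/-- The function `x ↦ e^{λ ω(|x|)} ‖Dⁿ f(x)‖`; here `Dⁿ f` is the full `n`-th derivative, so that
a bound for it is a bound for all the partial derivatives of `f` of order `n`. -/
def weightedDeriv (ω : OmegaWeight) {ι : Type*} [Fintype ι] (l : ℝ) (n : ℕ)
    (f : EuclideanSpace ℝ ι → ℂ) (x : EuclideanSpace ℝ ι) : ℝ :=
  Real.exp (l * ω.toFun ‖x‖) * ‖iteratedFDeriv ℝ n f x‖

theorem weightedDeriv_nonneg (ω : OmegaWeight) {ι : Type*} [Fintype ι] (l : ℝ) (n : ℕ)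
    (f : EuclideanSpace ℝ ι → ℂ) (x : EuclideanSpace ℝ ι) : 0 ≤ weightedDeriv ω l n f x := by
  unfold weightedDeriv; positivity

theorem weightedDeriv_add_le (ω : OmegaWeight) {ι : Type*} [Fintype ι] (l : ℝ) (n : ℕ)
    (f g : 𝓢(EuclideanSpace ℝ ι, ℂ)) (x : EuclideanSpace ℝ ι) :
    weightedDeriv ω l n (f + g : 𝓢(EuclideanSpace ℝ ι, ℂ)) x ≤
      weightedDeriv ω l n f x + weightedDeriv ω l n g x := by
  unfold weightedDeriv
  have h : iteratedFDeriv ℝ n (f + g : 𝓢(EuclideanSpace ℝ ι, ℂ)) x =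
      iteratedFDeriv ℝ n f x + iteratedFDeriv ℝ n g x :=
    iteratedFDeriv_add_apply (f.contDiffAt n) (g.contDiffAt n)
  rw [h, ← mul_add]
  gcongr
  exact norm_add_le _ _

theorem weightedDeriv_smul (ω : OmegaWeight) {ι : Type*} [Fintype ι] (l : ℝ) (n : ℕ)
    (c : ℂ) (f : 𝓢(EuclideanSpace ℝ ι, ℂ)) (x : EuclideanSpace ℝ ι) :
    weightedDeriv ω l n (c • f : 𝓢(EuclideanSpace ℝ ι, ℂ)) x = ‖c‖ * weightedDeriv ω l n f x := by
  unfold weightedDeriv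
  have h : iteratedFDeriv ℝ n (c • f : 𝓢(EuclideanSpace ℝ ι, ℂ)) x =
      c • iteratedFDeriv ℝ n f x :=
    iteratedFDeriv_const_smul_apply (f.contDiffAt n)
  rw [h, norm_smul]
  ring

/-- The Schwartz functions all of whose derivatives are `O(e^{-λ ω})` for every `λ > 0`. -/
def omegaDecaySubmodule (ω : OmegaWeight) (ι : Type*) [Fintype ι] :
    Submodule ℂ 𝓢(EuclideanSpace ℝ ι, ℂ) where
  carrier := {f | ∀ l : ℝ, 0 < l → ∀ n : ℕ, BddAbove (range (weightedDeriv ω l n f))}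
  zero_mem' l _ n := by
    refine ⟨0, ?_⟩
    rintro _ ⟨x, rfl⟩
    have := weightedDeriv_smul ω l n 0 (0 : 𝓢(EuclideanSpace ℝ ι, ℂ)) x
    rw [zero_smul, norm_zero, zero_mul] at this
    exact this.le
  add_mem' {f g} hf hg l hl n := by
    obtain ⟨A, hA⟩ := hf l hl n
    obtain ⟨B, hB⟩ := hg l hl n
    refine ⟨A + B, ?_⟩
    rintro _ ⟨x, rfl⟩
    exact (weightedDeriv_add_le ω l n f g x).trans (add_le_add (hA ⟨x, rfl⟩) (hB ⟨x, rfl⟩))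
  smul_mem' c f hf l hl n := by
    obtain ⟨A, hA⟩ := hf l hl n
    refine ⟨‖c‖ * A, ?_⟩
    rintro _ ⟨x, rfl⟩
    rw [weightedDeriv_smul]
    exact mul_le_mul_of_nonneg_left (hA ⟨x, rfl⟩) (norm_nonneg c)

/-- The space `𝓢_ω(ℝ^ι)`: the Schwartz functions `u` such that `e^{λω} |D^α u|` and
`e^{λω} |D^α û|` are bounded for all `λ > 0` and all `α`. -/
def OmegaSchwartz (ω : OmegaWeight) (ι : Type*) [Fintype ι] : Type _ :=
  ↥(omegaDecaySubmodule ω ι ⊓ (omegaDecaySubmodule ω ι).comap (schwartzFourier ι))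

namespace OmegaSchwartz

variable {ω : OmegaWeight} {ι : Type*} [Fintype ι]

instance : AddCommGroup (OmegaSchwartz ω ι) :=
  inferInstanceAs (AddCommGroup
    ↥(omegaDecaySubmodule ω ι ⊓ (omegaDecaySubmodule ω ι).comap (schwartzFourier ι)))

instance : Module ℂ (OmegaSchwartz ω ι) :=
  inferInstanceAs (Module ℂ
    ↥(omegaDecaySubmodule ω ι ⊓ (omegaDecaySubmodule ω ι).comap (schwartzFourier ι)))

/-- The inclusion of `𝓢_ω` in the Schwartz space. -/
def toSchwartz (ω : OmegaWeight) (ι : Type*) [Fintype ι] :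
    OmegaSchwartz ω ι →ₗ[ℂ] 𝓢(EuclideanSpace ℝ ι, ℂ) :=
  (omegaDecaySubmodule ω ι ⊓ (omegaDecaySubmodule ω ι).comap (schwartzFourier ι)).subtype

instance : CoeFun (OmegaSchwartz ω ι) (fun _ => EuclideanSpace ℝ ι → ℂ) :=
  ⟨fun f => toSchwartz ω ι f⟩

theorem mem_decay (f : OmegaSchwartz ω ι) :
    toSchwartz ω ι f ∈ omegaDecaySubmodule ω ι := f.2.1

theorem fourier_mem_decay (f : OmegaSchwartz ω ι) :
    schwartzFourier ι (toSchwartz ω ι f) ∈ omegaDecaySubmodule ω ι := f.2.2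

/-- The seminorm `u ↦ sup_x e^{λ ω(x)} ‖Dⁿ (L u)(x)‖` for a linear map `L` with values in the
functions for which these suprema are finite. -/
def seminormOf (L : OmegaSchwartz ω ι →ₗ[ℂ] 𝓢(EuclideanSpace ℝ ι, ℂ))
    (hL : ∀ f, L f ∈ omegaDecaySubmodule ω ι) (i : Ioi (0 : ℝ) × ℕ) :
    Seminorm ℂ (OmegaSchwartz ω ι) :=
  Seminorm.of (fun f => ⨆ x, weightedDeriv ω i.1 i.2 (L f) x)
    (fun f g => by
      refine ciSup_le fun x => ?_
      rw [map_add]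
      exact (weightedDeriv_add_le ω _ _ _ _ x).trans
        (add_le_add (le_ciSup (hL f i.1 i.1.2 i.2) x) (le_ciSup (hL g i.1 i.1.2 i.2) x)))
    (fun c f => by
      rw [Real.mul_iSup_of_nonneg (norm_nonneg c)]
      congr 1
      ext x
      rw [map_smul, weightedDeriv_smul])

/-- The seminorms `sup e^{λω} ‖Dⁿ u‖` and `sup e^{λω} ‖Dⁿ û‖`, for `λ > 0` and `n ∈ ℕ`. -/
def seminormFamily (ω : OmegaWeight) (ι : Type*) [Fintype ι] :
    SeminormFamily ℂ (OmegaSchwartz ω ι) ((Ioi (0 : ℝ) × ℕ) ⊕ (Ioi (0 : ℝ) × ℕ)) :=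
  Sum.elim (seminormOf (toSchwartz ω ι) mem_decay)
    (seminormOf (schwartzFourier ι ∘ₗ toSchwartz ω ι) fourier_mem_decay)

/-- The locally convex topology of `𝓢_ω`. -/
instance : TopologicalSpace (OmegaSchwartz ω ι) :=
  (seminormFamily ω ι).moduleFilterBasis.topology'

theorem withSeminorms (ω : OmegaWeight) (ι : Type*) [Fintype ι] :
    WithSeminorms (seminormFamily ω ι) := ⟨rfl⟩

instance : IsTopologicalAddGroup (OmegaSchwartz ω ι) :=
  (withSeminorms ω ι).topologicalAddGroup

instance : ContinuousSMul ℂ (OmegaSchwartz ω ι) :=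
  (withSeminorms ω ι).continuousSMul

theorem norm_apply_le (f : OmegaSchwartz ω ι) (x : EuclideanSpace ℝ ι) :
    ‖f x‖ ≤ seminormFamily ω ι (Sum.inl (⟨1, mem_Ioi.2 one_pos⟩, 0)) f := by
  refine le_trans ?_ (le_ciSup (mem_decay f 1 one_pos 0) x)
  unfold weightedDeriv
  rw [norm_iteratedFDeriv_zero]
  refine le_mul_of_one_le_left (norm_nonneg _) (Real.one_le_exp ?_)
  rw [one_mul]
  exact ω.nonneg _ (norm_nonneg x)

theorem integrable_mul (f g : OmegaSchwartz ω ι) : Integrable (fun x => f x * g x) := by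
  refine (toSchwartz ω ι f).integrable.mul_bdd
    (c := seminormFamily ω ι (Sum.inl (⟨1, mem_Ioi.2 one_pos⟩, 0)) g)
    (toSchwartz ω ι g).continuous.aestronglyMeasurable ?_
  exact Filter.Eventually.of_forall fun x => norm_apply_le g x

end OmegaSchwartz

/-- The space `𝓢'_ω(ℝ^ι)` of `ω`-tempered distributions: the continuous linear functionals on
`𝓢_ω(ℝ^ι)`, with the strong topology (uniform convergence on bounded sets). -/
abbrev OmegaDistribution (ω : OmegaWeight) (ι : Type*) [Fintype ι] : Type _ :=
  OmegaSchwartz ω ι →L[ℂ] ℂ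

/-- The linear functional `g ↦ ∫ f g` on `𝓢_ω`. -/
def OmegaSchwartz.pairing {ω : OmegaWeight} {ι : Type*} [Fintype ι]
    (f : OmegaSchwartz ω ι) : OmegaSchwartz ω ι →ₗ[ℂ] ℂ where
  toFun g := ∫ x, f x * g x
  map_add' g h := by
    rw [← integral_add (f.integrable_mul g) (f.integrable_mul h)]
    congr 1
    ext x
    rw [map_add, add_apply, mul_add]
  map_smul' c g := by
    rw [RingHom.id_apply, smul_eq_mul, ← integral_const_mul]
    congr 1
    ext x
    rw [map_smul, smul_apply, smul_eq_mul, mul_left_comm]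

/-- The embedding of `𝓢_ω` in `𝓢'_ω`: the function `f` acts by `g ↦ ∫ f g`. -/
def OmegaSchwartz.toDistribution {ω : OmegaWeight} {ι : Type*} [Fintype ι]
    (f : OmegaSchwartz ω ι) : OmegaDistribution ω ι where
  toLinearMap := f.pairing
  cont := by
    refine WithSeminorms.continuous_normedSpace_rng ℂ (OmegaSchwartz.withSeminorms ω ι)
      f.pairing ⟨{Sum.inl (⟨1, mem_Ioi.2 one_pos⟩, 0)}, (∫ x, ‖f x‖).toNNReal, fun g => ?_⟩
    rw [Finset.sup_singleton]
    change ‖∫ x, f x * g x‖ ≤ ((∫ x, ‖f x‖).toNNReal : ℝ) * _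
    rw [Real.coe_toNNReal _ (integral_nonneg fun x => norm_nonneg _), ← integral_mul_const]
    refine norm_integral_le_of_norm_le
      ((OmegaSchwartz.toSchwartz ω ι f).integrable.norm.mul_const _)
      (Filter.Eventually.of_forall fun x => ?_)
    rw [norm_mul]
    exact mul_le_mul_of_nonneg_left (g.norm_apply_le x) (norm_nonneg _)

/-- The Kohn–Nirenberg quantization
`a(x,D)f(x) = (2π)^{-d} ∫ e^{i⟨x,ξ⟩} a(x,ξ) f̂(ξ) dξ` of a symbol `a` on `ℝ^{2d}`. -/
def kohnNirenberg {d : ℕ} (a : EuclideanSpace ℝ (Fin d ⊕ Fin d) → ℂ)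
    (f : EuclideanSpace ℝ (Fin d) → ℂ) (x : EuclideanSpace ℝ (Fin d)) : ℂ :=
  ((2 * Real.pi : ℂ) ^ d)⁻¹ *
    ∫ ξ : EuclideanSpace ℝ (Fin d), Complex.exp (Complex.I * (⟪x, ξ⟫_ℝ : ℂ)) *
      a (WithLp.toLp 2 (Sum.elim x ξ)) * omegaFourier f ξ

/-- `T` is a continuous linear extension to `𝓢'_ω` of the operator `a(x,D)` on `𝓢_ω`: for every
`f ∈ 𝓢_ω` the function `a(x,D)f` belongs to `𝓢_ω`, and `T` maps (the distribution) `f` to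
(the distribution) `a(x,D)f`. -/
def IsKohnNirenbergExtension {ω : OmegaWeight} {d : ℕ}
    (a : EuclideanSpace ℝ (Fin d ⊕ Fin d) → ℂ)
    (T : OmegaDistribution ω (Fin d) →L[ℂ] OmegaDistribution ω (Fin d)) : Prop :=
  ∀ f : OmegaSchwartz ω (Fin d), ∃ g : OmegaSchwartz ω (Fin d),
    (∀ x, g x = kohnNirenberg a f x) ∧ T f.toDistribution = g.toDistribution

end

/-! On `𝓢_ω` the operator is `c ∫ k(x,ξ) f̂(ξ) dξ` with kernel `k(x,ξ) = e^{i⟨x,ξ⟩} a(x,ξ)` and `c =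
(2π)^{-d}`. Its formal transpose is `S = c F ∘ N`, where `F` is the Fourier transform and `N`
integrates `k` in the variable `x`. Once `S` is continuous on `𝓢_ω`, the extension is `u ↦ u ∘ S`.
It is unique because `𝓢_ω` is sequentially dense in `𝓢'_ω`. It regularizes because `v ∘ N` is given
by the function `x ↦ v(k(x,·))`, whose membership in `𝓢_ω` comes from the decay of `k` in both
variables.

Everything is measured by the Gabor transform `Wf(x,ξ)`, the integral of `f` against a Gaussian
shifted to the point `(x,ξ)` of phase space. Decay of `f` gives decay of `Wf` in `x`. The Fourier
transform acts on phase space as a quarter turn, so decay of `f̂` gives decay in `ξ`, and a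
geometric mean of the two bounds gives joint decay (`exists_norm_gaborTransform_le`). Conversely the
inversion formula writes `f` as a superposition of atoms, and differentiating it recovers every
seminorm (`GaborDecay.contDiff_and_bound`). Hence a bounded continuous function whose transform is
`O(e^{-lω})` for all `l` lies in `𝓢_ω` (`GaborDecay.exists_omegaSchwartz`), and the topology of
`𝓢_ω` is given by weighted norms of `Wf`.

By Hahn–Banach and Riesz in a weighted `L²`, every `u ∈ 𝓢'_ω` is `g ↦ ∫ U · Wg` with a density `U`
of controlled growth (`exists_representation`). Truncating `U` proves density
(`exists_tendsto_toDistribution`), and pairing `U` with the transform of `k(x,·)` proves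
regularization (`KernelDecay.exists_comp_eq_toDistribution`). The decay of the transforms of `k` is
`SymbolDecay.exists_gaborTransform_symbolKernel_le`. -/

namespace OmegaWeight

/-! ### Growth of the weight function. -/

variable (ω : OmegaWeight) {E : Type*} [NormedAddCommGroup E]

/-- The radial weight `x ↦ ω(|x|)`. -/
def wt (x : E) : ℝ := ω.toFun ‖x‖

/-- The weight `(x, ξ) ↦ ω(|x|) + ω(|ξ|)` on phase space. -/
def wt₂ (z : E × E) : ℝ := ω.wt z.1 + ω.wt z.2

theorem wt_nonneg (x : E) : 0 ≤ ω.wt x := ω.nonneg _ (norm_nonneg x)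

theorem wt₂_nonneg (z : E × E) : 0 ≤ ω.wt₂ z := add_nonneg (ω.wt_nonneg _) (ω.wt_nonneg _)

theorem continuous_wt : Continuous (ω.wt : E → ℝ) :=
  ω.continuousOn.comp_continuous continuous_norm fun x => norm_nonneg x

theorem continuous_wt₂ : Continuous (ω.wt₂ : E × E → ℝ) :=
  (ω.continuous_wt.comp continuous_fst).add (ω.continuous_wt.comp continuous_snd)

theorem wt_le_of_norm_le {F : Type*} [NormedAddCommGroup F] {x : E} {y : F} (h : ‖x‖ ≤ ‖y‖) :
    ω.wt x ≤ ω.wt y :=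
  ω.monotoneOn (norm_nonneg x) (norm_nonneg y) h

theorem wt_add_le (x y : E) : ω.wt (x + y) ≤ ω.wt x + ω.wt y :=
  (ω.monotoneOn (norm_nonneg _) (add_nonneg (norm_nonneg x) (norm_nonneg y))
    (norm_add_le x y)).trans (ω.subadditive _ _ (norm_nonneg x) (norm_nonneg y))

theorem wt_neg (x : E) : ω.wt (-x) = ω.wt x := by simp [wt]

theorem wt_sub_comm (x y : E) : ω.wt (x - y) = ω.wt (y - x) := by simp [wt, norm_sub_rev]

theorem wt_le_add_sub (x y : E) : ω.wt x ≤ ω.wt y + ω.wt (x - y) := by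
  simpa using ω.wt_add_le y (x - y)

theorem toFun_natCast_le (n : ℕ) : ω.toFun n ≤ ω.toFun 0 + n * ω.toFun 1 := by
  induction n with
  | zero => simp
  | succ n ih =>
    push_cast
    linarith [ω.subadditive n 1 n.cast_nonneg zero_le_one]

theorem exists_le_linear : ∃ A, 0 ≤ A ∧ ∀ t, 0 ≤ t → ω.toFun t ≤ A * (1 + t) := by
  have h0 := ω.nonneg 0 le_rfl
  have h1 := ω.nonneg 1 zero_le_one
  refine ⟨ω.toFun 0 + ω.toFun 1, by positivity, fun t ht => ?_⟩
  have h := ω.monotoneOn ht (mem_Ici.2 (Nat.cast_nonneg _)) (Nat.le_ceil t)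
  have h2 := ω.toFun_natCast_le ⌈t⌉₊
  have h3 := Nat.ceil_lt_add_one ht
  nlinarith

/-- Subadditivity forces at most linear growth of `ω`, which a Gaussian beats. The constant comes
from completing the square in `|l| A t ≤ t²/2 + (|l| A)²/2`. -/
theorem exists_gaussian_le (l : ℝ) :
    ∃ C, 0 ≤ C ∧ ∀ t, 0 ≤ t → Real.exp (-(t ^ 2 / 2)) ≤ C * Real.exp (-(l * ω.toFun t)) := by
  obtain ⟨A, hA, h⟩ := ω.exists_le_linear
  refine ⟨Real.exp (|l| * A + (|l| * A) ^ 2 / 2), by positivity, fun t ht => ?_⟩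
  rw [← Real.exp_add, Real.exp_le_exp]
  have h1 : l * ω.toFun t ≤ |l| * (A * (1 + t)) :=
    (mul_le_mul_of_nonneg_right (le_abs_self l) (ω.nonneg t ht)).trans
      (mul_le_mul_of_nonneg_left (h t ht) (abs_nonneg l))
  nlinarith [sq_nonneg (t - |l| * A)]

/-- This is where condition `(γ)` enters: `n log t ≤ l ω(t)` for large `t`, and the factor `(1 +
S)^n` covers the remaining bounded range. It makes `e^{-lω}` integrable and lets `e^{lω}` absorb
polynomials. -/
theorem exists_one_add_pow_le (n : ℕ) {l : ℝ} (hl : 0 < l) :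
    ∃ C, 0 ≤ C ∧ ∀ t, 0 ≤ t → (1 + t) ^ n ≤ C * Real.exp (l * ω.toFun t) := by
  have hc : 0 < l / (n + 1) := by positivity
  obtain ⟨R, hR⟩ := eventually_atTop.1 (ω.log_isLittleO.bound hc)
  set S := max R 1
  refine ⟨(1 + S) ^ n * 2 ^ n, by positivity, fun t ht => ?_⟩
  have hω := ω.nonneg t ht
  have hS : 1 ≤ S := le_max_right _ _
  rcases le_total t S with hts | hts
  · calc (1 + t) ^ n ≤ (1 + S) ^ n := by gcongr
      _ ≤ (1 + S) ^ n * 2 ^ n * 1 := by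
        rw [mul_one]
        exact le_mul_of_one_le_right (by positivity) (one_le_pow₀ one_le_two)
      _ ≤ _ := by gcongr; exact Real.one_le_exp (by positivity)
  · have ht1 : 1 ≤ t := hS.trans hts
    have h := hR t ((le_max_left _ _).trans hts)
    rw [Real.norm_of_nonneg (Real.log_nonneg ht1), Real.norm_of_nonneg hω] at h
    have h2 : (n : ℝ) * Real.log t ≤ l * ω.toFun t := by
      calc (n : ℝ) * Real.log t ≤ n * (l / (n + 1) * ω.toFun t) := by gcongr
        _ ≤ (n + 1) * (l / (n + 1) * ω.toFun t) := by gcongr; linarith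
        _ = l * ω.toFun t := by field_simp
    calc (1 + t) ^ n ≤ (2 * t) ^ n := by gcongr; linarith
      _ = 2 ^ n * Real.exp (n * Real.log t) := by
        rw [mul_pow, Real.exp_nat_mul, Real.exp_log (by linarith)]
      _ ≤ 2 ^ n * Real.exp (l * ω.toFun t) := by gcongr
      _ ≤ _ := by
        gcongr
        exact le_mul_of_one_le_left (by positivity) (one_le_pow₀ (by linarith))

variable [NormedSpace ℝ E] [FiniteDimensional ℝ E] [MeasurableSpace E] [BorelSpace E]
  (μ : Measure E) [μ.IsAddHaarMeasure]

theorem integrable_exp_neg_wt {l : ℝ} (hl : 0 < l) :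
    Integrable (fun x : E => Real.exp (-(l * ω.wt x))) μ := by
  obtain ⟨C, hC, h⟩ := ω.exists_one_add_pow_le (Module.finrank ℝ E + 1) hl
  have hint := (integrable_one_add_norm (E := E) (μ := μ)
    (r := (Module.finrank ℝ E + 1 : ℕ)) (by push_cast; linarith)).const_mul C
  refine hint.mono' ?_ (Eventually.of_forall fun x => ?_)
  · exact (Real.continuous_exp.comp (ω.continuous_wt.const_mul l).neg).aestronglyMeasurable
  · rw [Real.norm_of_nonneg (Real.exp_pos _).le, Real.exp_neg, Real.rpow_neg (by positivity),
      Real.rpow_natCast]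
    rw [← div_eq_mul_inv, le_div_iff₀ (by positivity), inv_mul_le_iff₀ (by positivity), mul_comm]
    exact h _ (norm_nonneg x)

theorem integrable_exp_neg_wt₂ [SFinite μ] {l : ℝ} (hl : 0 < l) :
    Integrable (fun z : E × E => Real.exp (-(l * ω.wt₂ z))) (μ.prod μ) := by
  refine ((ω.integrable_exp_neg_wt μ hl).mul_prod (ω.integrable_exp_neg_wt μ hl)).congr
    (Eventually.of_forall fun z => ?_)
  simp only [wt₂, ← Real.exp_add]
  ring_nf

end OmegaWeight

/-- The smaller of two exponentials is at most their geometric mean. Decay in one group of variables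
and decay in another thus combine into joint decay at half the rate. -/
theorem le_exp_of_le_of_le {r A B s t : ℝ} (hA : 0 ≤ A) (hB : 0 ≤ B)
    (h₁ : r ≤ A * Real.exp s) (h₂ : r ≤ B * Real.exp t) :
    r ≤ (A + B) * Real.exp ((s + t) / 2) := by
  have h1 : r ≤ (A + B) * Real.exp s := h₁.trans (by gcongr; linarith)
  have h2 : r ≤ (A + B) * Real.exp t := h₂.trans (by gcongr; linarith)
  rcases le_total s t with h | h
  · exact h1.trans (by gcongr; linarith)
  · exact h2.trans (by gcongr; linarith)

/-! ### Differentiation under the integral sign to all orders. -/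

section DiffIntegral

variable {α : Type*} [MeasurableSpace α] {μ : Measure α} {E F : Type*}
  [NormedAddCommGroup E] [NormedSpace ℝ E] [NormedAddCommGroup F] [NormedSpace ℝ F]

/-- Differentiation under the integral sign, with the derivative described by its values. -/
theorem exists_hasFDerivAt_integral {φ : α → E → F} {φ' : α → E → E →L[ℝ] F} {B : α → ℝ}
    (hm : ∀ t, AEStronglyMeasurable (fun z => φ z t) μ)
    (hm' : ∀ t, AEStronglyMeasurable (fun z => φ' z t) μ) (hi : ∀ t, Integrable (fun z => φ z t) μ)
    (hd : ∀ z t, HasFDerivAt (φ z) (φ' z t) t) (hB : Integrable B μ)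
    (hle : ∀ z t, ‖φ' z t‖ ≤ B z) (t : E) :
    ∃ D : E →L[ℝ] F, HasFDerivAt (fun t => ∫ z, φ z t ∂μ) D t ∧
      ∀ v, D v = ∫ z, φ' z t v ∂μ := by
  refine ⟨∫ z, φ' z t ∂μ, ?_, fun v => ?_⟩
  · exact hasFDerivAt_integral_of_dominated_of_fderiv_le (bound := B)
      (F' := fun t z => φ' z t) univ_mem (Eventually.of_forall hm) (hi t) (hm' t)
      (Eventually.of_forall fun z x _ => hle z x) hB (Eventually.of_forall fun z x _ => hd z x)
  · exact ContinuousLinearMap.integral_apply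
      (hB.mono' (hm' t) (Eventually.of_forall fun z => hle z t)) v

/-- Repeated differentiation under the integral sign. -/
theorem iteratedFDeriv_integral {κ : α → E → F} (hκ : ∀ z, ContDiff ℝ (⊤ : ℕ∞) (κ z))
    (hm : ∀ n t, AEStronglyMeasurable (fun z => iteratedFDeriv ℝ n (κ z) t) μ)
    {B : ℕ → α → ℝ} (hB : ∀ n, Integrable (B n) μ)
    (hle : ∀ n z t, ‖iteratedFDeriv ℝ n (κ z) t‖ ≤ B n z) :
    ContDiff ℝ (⊤ : ℕ∞) (fun t => ∫ z, κ z t ∂μ) ∧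
      ∀ n t, iteratedFDeriv ℝ n (fun t => ∫ z, κ z t ∂μ) t =
        ∫ z, iteratedFDeriv ℝ n (κ z) t ∂μ := by
  have hi : ∀ n t, Integrable (fun z => iteratedFDeriv ℝ n (κ z) t) μ := fun n t =>
    (hB n).mono' (hm n t) (Eventually.of_forall fun z => hle n z t)
  -- The derivative of the `n`-th iterated derivative is the next one up to an isometry, so `B (n +
  -- 1)` dominates it.
  have hcurry : ∀ n z, fderiv ℝ (iteratedFDeriv ℝ n (κ z)) =
      (continuousMultilinearCurryLeftEquiv ℝ (fun _ : Fin (n + 1) => E) F) ∘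
        iteratedFDeriv ℝ (n + 1) (κ z) := fun n z => by
    rw [fderiv_iteratedFDeriv]
  have hderiv : ∀ n t, ∃ D, HasFDerivAt (fun t => ∫ z, iteratedFDeriv ℝ n (κ z) t ∂μ) D t ∧
      ∀ v, D v = ∫ z, fderiv ℝ (iteratedFDeriv ℝ n (κ z)) t v ∂μ := fun n t => by
    refine exists_hasFDerivAt_integral (B := B (n + 1)) (hm n) (fun t => ?_) (hi n)
      (fun z t => (((hκ z).differentiable_iteratedFDeriv
        (by exact_mod_cast ENat.natCast_lt_top n)) t).hasFDerivAt) (hB (n + 1)) (fun z t => ?_) t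
    · simp only [hcurry]
      exact (LinearIsometryEquiv.continuous _).comp_aestronglyMeasurable (hm (n + 1) t)
    · rw [norm_fderiv_iteratedFDeriv]; exact hle (n + 1) z t
  have hmain : ∀ n, iteratedFDeriv ℝ n (fun t => ∫ z, κ z t ∂μ) =
      fun t => ∫ z, iteratedFDeriv ℝ n (κ z) t ∂μ := by
    intro n
    induction n with
    | zero =>
      ext1 t
      simp only [iteratedFDeriv_zero_eq_comp, Function.comp_apply]
      exact ((continuousMultilinearCurryFin0 ℝ E F).symm.toContinuousLinearEquiv.integral_comp_comm
        _).symm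
    | succ n ih =>
      ext1 t
      obtain ⟨D, hD, hDv⟩ := hderiv n t
      ext m
      rw [iteratedFDeriv_succ_apply_left, ih, hD.fderiv, hDv,
        ContinuousMultilinearMap.integral_apply,
        ContinuousMultilinearMap.integral_apply (hi (n + 1) t)]
      · simp only [iteratedFDeriv_succ_apply_left]
      · have : ∀ z, fderiv ℝ (iteratedFDeriv ℝ n (κ z)) t (m 0) =
            (iteratedFDeriv ℝ (n + 1) (κ z) t).curryLeft (m 0) := fun z => by rw [hcurry]; rfl
        simp only [this]
        refine ((hB (n + 1)).mul_const ‖m 0‖).mono' ?_ (Eventually.of_forall fun z => ?_)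
        · exact ((ContinuousLinearMap.apply ℝ _ (m 0)).continuous.comp
            (continuousMultilinearCurryLeftEquiv ℝ
              (fun _ : Fin (n + 1) => E) F).continuous).comp_aestronglyMeasurable (hm (n + 1) t)
        · rw [← this]
          refine (ContinuousLinearMap.le_opNorm _ _).trans ?_
          rw [norm_fderiv_iteratedFDeriv]
          gcongr
          exact hle (n + 1) z t
  refine ⟨contDiff_of_differentiable_iteratedFDeriv fun n _ => ?_, fun n t => by rw [hmain]⟩
  rw [hmain]
  intro t
  obtain ⟨D, hD, -⟩ := hderiv n t
  exact hD.differentiableAt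

end DiffIntegral

theorem norm_iteratedFDeriv_cexp (n : ℕ) (w : ℂ) :
    ‖iteratedFDeriv ℝ n Complex.exp w‖ = ‖Complex.exp w‖ := by
  rw [← (Complex.contDiff_exp (𝕜 := ℂ) (n := n)).contDiffAt.restrictScalars_iteratedFDeriv (𝕜 := ℝ),
    Function.comp_apply, ContinuousMultilinearMap.norm_restrictScalars,
    norm_iteratedFDeriv_eq_norm_iteratedDeriv, iteratedDeriv_eq_iterate, Complex.iter_deriv_exp]

/-! ### Gaussian atoms and their derivatives. -/

section Gabor

variable {E : Type*} [NormedAddCommGroup E] [InnerProductSpace ℝ E]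

/-- The time-frequency shift `t ↦ e^{i⟨ξ,t⟩} e^{-|t-x|²/2}` of a Gaussian, for `z = (x, ξ)`. -/
noncomputable def gabor (z : E × E) (t : E) : ℂ :=
  Complex.exp (Complex.I * (⟪z.2, t⟫_ℝ : ℂ) - ((‖t - z.1‖ ^ 2 / 2 : ℝ) : ℂ))

theorem norm_gabor (z : E × E) (t : E) : ‖gabor z t‖ = Real.exp (-(‖t - z.1‖ ^ 2 / 2)) := by
  rw [gabor, Complex.norm_exp, Complex.sub_re, Complex.ofReal_re]
  congr 1
  simp

theorem norm_gabor_le_one (z : E × E) (t : E) : ‖gabor z t‖ ≤ 1 := by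
  rw [norm_gabor, Real.exp_le_one_iff]
  exact neg_nonpos.2 (by positivity)

theorem continuous_gabor : Continuous (fun p : (E × E) × E => gabor p.1 p.2) := by
  unfold gabor
  fun_prop

theorem contDiff_gabor (n : WithTop ℕ∞) (z : E × E) : ContDiff ℝ n (gabor z) := by
  unfold gabor
  refine Complex.contDiff_exp.comp (ContDiff.sub (contDiff_const.mul ?_) ?_)
  · exact Complex.ofRealCLM.contDiff.comp (contDiff_const.inner ℝ contDiff_id)
  · exact Complex.ofRealCLM.contDiff.comp
      (((contDiff_id.sub contDiff_const).norm_sq ℝ).div_const _)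

/-- The exponent is quadratic in `t`: its gradient is at most `‖ξ‖ + ‖t - x‖`, its Hessian has norm
at most one, and higher derivatives vanish. So the `i`-th derivative is at most the `i`-th power of
`1 + ‖ξ‖ + ‖t - x‖`, as the Faà di Bruno estimate requires. -/
theorem norm_iteratedFDeriv_gabor_le (n : ℕ) (z : E × E) (t : E) :
    ‖iteratedFDeriv ℝ n (gabor z) t‖ ≤
      n.factorial * Real.exp (-(‖t - z.1‖ ^ 2 / 2)) * (1 + ‖z.2‖ + ‖t - z.1‖) ^ n := by
  set p : E → ℂ := fun t => Complex.I * (⟪z.2, t⟫_ℝ : ℂ) - ((‖t - z.1‖ ^ 2 / 2 : ℝ) : ℂ) with hp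
  have hpd : ContDiff ℝ n p := by
    refine ContDiff.sub (contDiff_const.mul ?_) ?_
    · exact Complex.ofRealCLM.contDiff.comp (contDiff_const.inner ℝ contDiff_id)
    · exact Complex.ofRealCLM.contDiff.comp
        (((contDiff_id.sub contDiff_const).norm_sq ℝ).div_const _)
  let B : E →L[ℝ] E →L[ℝ] ℂ :=
    (ContinuousLinearMap.compL ℝ E ℝ ℂ Complex.ofRealCLM).comp (innerSL ℝ)
  have hB : ∀ x y, B x y = (⟪x, y⟫_ℝ : ℂ) := fun x y => rfl
  have hBn : ∀ x, ‖B x‖ ≤ ‖x‖ := fun x => by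
    refine ContinuousLinearMap.opNorm_le_bound _ (norm_nonneg _) fun y => ?_
    rw [hB, Complex.norm_real]
    exact norm_inner_le_norm x y
  have h1 : fderiv ℝ p = fun t => (Complex.I • B z.2 + B z.1) - B t := by
    ext1 t
    refine HasFDerivAt.fderiv ?_
    have e : HasFDerivAt (fun t => ((‖t - z.1‖ ^ 2 / 2 : ℝ) : ℂ)) (B (t - z.1)) t := by
      have := (((hasFDerivAt_id t).sub_const z.1).norm_sq.mul_const (2 : ℝ)⁻¹)
      refine (Complex.ofRealCLM.hasFDerivAt.comp t this).congr_fderiv ?_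
      ext v
      simp [hB]
    refine (((B z.2).hasFDerivAt.const_mul Complex.I).sub e).congr_fderiv ?_
    ext v
    simp [hB]
    ring
  have h2 : fderiv ℝ (fderiv ℝ p) = fun _ => -B := by
    rw [h1]
    ext1 t
    exact (B.hasFDerivAt.const_sub _).fderiv
  refine norm_iteratedFDeriv_comp_le Complex.contDiff_exp hpd le_rfl t (fun i _ => ?_) ?_
  · rw [norm_iteratedFDeriv_cexp, ← norm_gabor]
    rfl
  · intro i hi _
    have hD : 1 ≤ 1 + ‖z.2‖ + ‖t - z.1‖ := by
      linarith [norm_nonneg z.2, norm_nonneg (t - z.1)]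
    obtain ⟨i, rfl⟩ := Nat.exists_eq_add_of_le' hi
    rw [← norm_iteratedFDeriv_fderiv]
    rcases i with _ | i
    · rw [norm_iteratedFDeriv_zero, h1, pow_one]
      calc ‖Complex.I • B z.2 + B z.1 - B t‖ = ‖Complex.I • B z.2 - B (t - z.1)‖ := by
            rw [map_sub]; congr 1; abel
        _ ≤ ‖Complex.I • B z.2‖ + ‖B (t - z.1)‖ := norm_sub_le _ _
        _ ≤ ‖z.2‖ + ‖t - z.1‖ := by
            gcongr
            · rw [norm_smul, Complex.norm_I, one_mul]; exact hBn _
            · exact hBn _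
        _ ≤ _ := by linarith
    · rw [← norm_iteratedFDeriv_fderiv, h2]
      refine le_trans ?_ (one_le_pow₀ hD)
      rcases i with _ | i
      · rw [norm_iteratedFDeriv_zero, norm_neg]
        exact ContinuousLinearMap.opNorm_le_bound _ zero_le_one fun x => by
          rw [one_mul]; exact hBn x
      · rw [iteratedFDeriv_succ_const]
        simp

end Gabor

/-! ### The Gabor transform, its Fourier covariance and its inversion. -/

section Transform

variable {ι : Type*} [Fintype ι]

local notation "𝔼" => EuclideanSpace ℝ

/-- The Gabor transform `(x, ξ) ↦ ∫ f(t) e^{i⟨ξ,t⟩} e^{-|t-x|²/2} dt`. -/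
noncomputable def gaborTransform (f : 𝔼 ι → ℂ) (z : 𝔼 ι × 𝔼 ι) : ℂ :=
  ∫ t, f t * gabor z t

theorem integrable_exp_neg_norm_sq {b : ℝ} (hb : 0 < b) (x : 𝔼 ι) :
    Integrable (fun t : 𝔼 ι => Real.exp (-(b * ‖t - x‖ ^ 2))) := by
  have h := (GaussianFourier.integrable_cexp_neg_mul_sq_norm_add (V := 𝔼 ι) (b := b)
    (by simpa using hb) 0 0).norm
  refine (h.comp_sub_right x).congr (Eventually.of_forall fun t => ?_)
  simp only [Complex.norm_exp]
  congr 1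
  rw [zero_mul, add_zero, ← Complex.ofReal_neg, ← Complex.ofReal_pow, ← Complex.ofReal_mul,
    Complex.ofReal_re]
  ring

theorem integrable_gabor (z : 𝔼 ι × 𝔼 ι) : Integrable (gabor z) := by
  refine (integrable_exp_neg_norm_sq (b := 1 / 2) (by norm_num) z.1).mono'
    (contDiff_gabor 0 z).continuous.aestronglyMeasurable (Eventually.of_forall fun t => ?_)
  rw [norm_gabor, one_div_mul_eq_div]

/-- The normalizing constant `(2π)^{d/2}`. -/
noncomputable def gaussianConst (ι : Type*) [Fintype ι] : ℂ :=
  (Real.pi / (1 / 2 : ℂ)) ^ (Module.finrank ℝ (𝔼 ι) / 2 : ℂ)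

theorem gaussianConst_ne_zero : gaussianConst ι ≠ 0 := by
  rw [gaussianConst, Complex.cpow_ne_zero_iff]
  left
  simp [Real.pi_ne_zero]

/-- The Gaussian is its own Fourier transform up to a constant, while translation and modulation
exchange roles. The effect is a quarter turn of phase space and a unimodular factor. -/
theorem omegaFourier_gabor (z : 𝔼 ι × 𝔼 ι) (ξ : 𝔼 ι) :
    omegaFourier (gabor z) ξ =
      gaussianConst ι * Complex.exp (Complex.I * (⟪z.1, z.2⟫_ℝ : ℂ)) * gabor (z.2, -z.1) ξ := by
  have h := GaussianFourier.integral_cexp_neg_mul_sq_norm_add (V := 𝔼 ι) (b := 1 / 2)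
    (by norm_num) Complex.I (z.2 - ξ)
  rw [omegaFourier, ← integral_add_right_eq_self _ z.1]
  calc _ = ∫ v : 𝔼 ι, Complex.exp (Complex.I * (⟪z.1, z.2 - ξ⟫_ℝ : ℂ)) *
        Complex.exp (-(1 / 2 : ℂ) * ‖v‖ ^ 2 + Complex.I * (⟪z.2 - ξ, v⟫_ℝ : ℂ)) := by
        congr 1
        ext v
        rw [gabor, ← Complex.exp_add, ← Complex.exp_add]
        congr 1
        simp only [inner_add_left, inner_add_right, inner_sub_left, inner_sub_right,
          add_sub_cancel_right, real_inner_comm ξ v, real_inner_comm z.2 z.1]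
        push_cast
        ring
    _ = _ := by
        rw [integral_const_mul, h, gaussianConst, gabor, mul_left_comm, mul_assoc]
        congr 1
        rw [← Complex.exp_add, ← Complex.exp_add]
        congr 1
        simp only [inner_sub_right, inner_neg_left, norm_sub_rev ξ z.2]
        push_cast
        rw [Complex.I_sq]
        ring

theorem norm_exp_I_inner {E : Type*} [NormedAddCommGroup E] [InnerProductSpace ℝ E] (x y : E) :
    ‖Complex.exp (Complex.I * (⟪x, y⟫_ℝ : ℂ))‖ = 1 := by
  rw [mul_comm, Complex.norm_exp_ofReal_mul_I]

theorem norm_exp_neg_I_inner {E : Type*} [NormedAddCommGroup E] [InnerProductSpace ℝ E] (x y : E) :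
    ‖Complex.exp (-(Complex.I * (⟪x, y⟫_ℝ : ℂ)))‖ = 1 := by
  rw [Complex.exp_neg, norm_inv, norm_exp_I_inner, inv_one]

theorem integral_omegaFourier_mul {f g : 𝔼 ι → ℂ} (hf : Integrable f) (hg : Integrable g) :
    ∫ x, omegaFourier f x * g x = ∫ x, f x * omegaFourier g x := by
  simp only [omegaFourier, ← integral_const_mul, ← integral_mul_const]
  rw [integral_integral_swap]
  · congr 1; ext x; congr 1; ext y
    rw [real_inner_comm]; ring
  · have h := (hf.mul_prod hg).swap
    refine h.norm.mono' ?_ (Eventually.of_forall fun p => ?_)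
    · have h1 : AEStronglyMeasurable (fun p : 𝔼 ι × 𝔼 ι =>
          Complex.exp (-(Complex.I * (⟪p.2, p.1⟫_ℝ : ℂ)))) (volume.prod volume) :=
        (by fun_prop : Continuous fun p : 𝔼 ι × 𝔼 ι =>
          Complex.exp (-(Complex.I * (⟪p.2, p.1⟫_ℝ : ℂ)))).aestronglyMeasurable
      refine (h1.mul h.aestronglyMeasurable).congr (Eventually.of_forall fun p => ?_)
      simp only [Pi.mul_apply, Function.uncurry, Function.comp_apply, Prod.fst_swap, Prod.snd_swap]
      ring
    · simp only [Function.uncurry, Function.comp_apply, Prod.fst_swap, Prod.snd_swap, norm_mul,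
        norm_exp_neg_I_inner, one_mul]
      exact le_rfl

/-- The atom at `z` is, up to factors, the Fourier transform of the atom at `(-z.2, z.1)`, and the
transform can be moved onto `f`. -/
theorem gaborTransform_eq_omegaFourier {f : 𝔼 ι → ℂ} (hf : Integrable f) (z : 𝔼 ι × 𝔼 ι) :
    gaborTransform f z = (gaussianConst ι)⁻¹ * Complex.exp (Complex.I * (⟪z.1, z.2⟫_ℝ : ℂ)) *
      gaborTransform (omegaFourier f) (-z.2, z.1) := by
  rw [gaborTransform, gaborTransform, integral_omegaFourier_mul hf (integrable_gabor _),
    ← integral_const_mul]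
  congr 1
  ext t
  rw [omegaFourier_gabor]
  simp only [neg_neg, inner_neg_left, Complex.ofReal_neg, mul_neg, Prod.mk.eta,
    real_inner_comm z.1 z.2]
  have h := gaussianConst_ne_zero (ι := ι)
  rw [Complex.exp_neg]
  field_simp

theorem omegaFourier_inversion {f : 𝔼 ι → ℂ} (hc : Continuous f) (hf : Integrable f)
    (hF : Integrable (omegaFourier f)) (t : 𝔼 ι) :
    f t = (((2 * Real.pi) ^ Fintype.card ι : ℝ) : ℂ)⁻¹ *
      ∫ ξ, Complex.exp (Complex.I * (⟪t, ξ⟫_ℝ : ℂ)) * omegaFourier f ξ := by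
  have hpi : 0 < 2 * Real.pi := by positivity
  have hFe : ∀ v, 𝓕 f v = omegaFourier f ((2 * Real.pi) • v) := fun v => by
    rw [omegaFourier_eq, smul_smul, inv_mul_cancel₀ hpi.ne', one_smul]
  have hF' : Integrable (𝓕 f) := by
    rw [show 𝓕 f = fun v => omegaFourier f ((2 * Real.pi) • v) from funext hFe]
    exact hF.comp_smul hpi.ne'
  have h := congrFun (hc.fourierInv_fourier_eq hf hF') t
  rw [Real.fourierInv_eq'] at h
  rw [← h]
  have := Measure.integral_comp_smul (volume : Measure (𝔼 ι))
    (fun ξ => Complex.exp (Complex.I * (⟪t, ξ⟫_ℝ : ℂ)) * omegaFourier f ξ) (2 * Real.pi)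
  rw [finrank_euclideanSpace, abs_of_pos (by positivity), ← Complex.coe_smul, smul_eq_mul,
    Complex.ofReal_inv] at this
  rw [← this]
  congr 1
  ext v
  rw [hFe, smul_eq_mul]
  congr 2
  rw [real_inner_smul_right, real_inner_comm]
  push_cast
  ring

/-- The constant in the inversion formula of the Gabor transform. -/
noncomputable def gaborConst (ι : Type*) [Fintype ι] : ℂ :=
  (((2 * Real.pi) ^ Fintype.card ι : ℝ) : ℂ)⁻¹ * ((∫ x : 𝔼 ι, Real.exp (-‖x‖ ^ 2) : ℝ) : ℂ)⁻¹

/-- For fixed `x`, `ξ ↦ Wf(x,-ξ)` is the Fourier transform of `f` times the Gaussian centred at `x`.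
Fourier inversion recovers this product. Multiplying by the Gaussian again and integrating over `x`
leaves `f(t)` times the constant `∫ e^{-|x|²} dx`. -/
theorem gaborTransform_inversion {f : 𝔼 ι → ℂ} (hc : Continuous f) {A : ℝ} (hA : ∀ t, ‖f t‖ ≤ A)
    (hW : Integrable (gaborTransform f)) (hWx : ∀ x, Integrable fun ξ => gaborTransform f (x, ξ))
    (t : 𝔼 ι) :
    f t = gaborConst ι * ∫ z, gaborTransform f z * gabor (z.1, -z.2) t := by
  have hx : ∀ x : 𝔼 ι, f t * (Real.exp (-‖t - x‖ ^ 2) : ℝ) =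
      (((2 * Real.pi) ^ Fintype.card ι : ℝ) : ℂ)⁻¹ *
        ∫ ξ, gaborTransform f (x, ξ) * gabor (x, -ξ) t := fun x => by
    set h : 𝔼 ι → ℂ := fun s => f s * gabor (x, 0) s with hh
    have hhc : Continuous h := hc.mul (contDiff_gabor 0 _).continuous
    have hhi : Integrable h := (integrable_gabor (x, 0)).bdd_mul (c := A) hc.aestronglyMeasurable
      (Eventually.of_forall hA)
    have hF : ∀ ξ, omegaFourier h ξ = gaborTransform f (x, -ξ) := fun ξ => by
      rw [omegaFourier, gaborTransform]
      congr 1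
      ext s
      simp only [hh, gabor]
      rw [mul_left_comm, ← Complex.exp_add]
      congr 2
      simp only [inner_zero_left, inner_neg_left, real_inner_comm ξ s]
      push_cast
      ring
    have hFi : Integrable (omegaFourier h) := by
      rw [show omegaFourier h = fun ξ => gaborTransform f (x, -ξ) from funext hF]
      exact (hWx x).comp_neg
    have hinv := omegaFourier_inversion hhc hhi hFi t
    have hg : ((Real.exp (-‖t - x‖ ^ 2) : ℝ) : ℂ) = gabor (x, 0) t * gabor (x, 0) t := by
      rw [gabor, ← Complex.exp_add, Complex.ofReal_exp]
      congr 1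
      simp only [inner_zero_left]
      push_cast
      ring
    rw [hg, ← mul_assoc]
    change h t * _ = _
    rw [hinv, mul_assoc, ← integral_mul_const]
    congr 1
    rw [← integral_neg_eq_self]
    congr 1
    ext ξ
    rw [hF, neg_neg, mul_comm (Complex.exp _), mul_assoc]
    congr 1
    rw [gabor, gabor, ← Complex.exp_add]
    congr 1
    simp only [inner_zero_left, inner_neg_left, inner_neg_right, real_inner_comm ξ t]
    push_cast
    ring
  have hpos : 0 < ∫ x : 𝔼 ι, Real.exp (-‖x‖ ^ 2) := by
    have := GaussianFourier.integral_rexp_neg_mul_sq_norm (V := 𝔼 ι) one_pos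
    simp only [neg_mul, one_mul] at this
    rw [this]
    positivity
  have hne : ((∫ x : 𝔼 ι, Real.exp (-‖x‖ ^ 2) : ℝ) : ℂ) ≠ 0 := by exact_mod_cast hpos.ne'
  have hint : Integrable (fun z : 𝔼 ι × 𝔼 ι => gaborTransform f z * gabor (z.1, -z.2) t) := by
    refine hW.mul_bdd (c := 1) ?_ (Eventually.of_forall fun z => norm_gabor_le_one _ _)
    exact (continuous_gabor.comp (by fun_prop : Continuous fun z : 𝔼 ι × 𝔼 ι =>
      ((z.1, -z.2), t))).aestronglyMeasurable
  have h1 : ∫ x : 𝔼 ι, Real.exp (-‖t - x‖ ^ 2) = ∫ x : 𝔼 ι, Real.exp (-‖x‖ ^ 2) :=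
    integral_sub_left_eq_self (fun x : 𝔼 ι => Real.exp (-‖x‖ ^ 2)) volume t
  rw [Measure.volume_eq_prod] at hint ⊢
  rw [integral_prod _ hint, gaborConst, mul_right_comm, ← integral_const_mul]
  simp only [← hx]
  rw [integral_const_mul, integral_complex_ofReal, h1]
  field_simp

end Transform

/-! ### Regularity and localization of the atoms in the phase-space variable. -/

section GaborEstimates

variable {E : Type*} [NormedAddCommGroup E] [InnerProductSpace ℝ E]

theorem contDiff_gabor_uncurry : ContDiff ℝ (⊤ : ℕ∞) (fun p : (E × E) × E => gabor p.1 p.2) := by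
  unfold gabor
  refine Complex.contDiff_exp.comp (ContDiff.sub (contDiff_const.mul ?_) ?_)
  · exact Complex.ofRealCLM.contDiff.comp
      ((contDiff_snd.comp contDiff_fst).inner ℝ contDiff_snd)
  · exact Complex.ofRealCLM.contDiff.comp
      (((contDiff_snd.sub (contDiff_fst.comp contDiff_fst)).norm_sq ℝ).div_const _)

/-- The atom is jointly smooth in `(z,t)`, and derivatives in `t` are total derivatives restricted
to the last factor. This supplies measurability in `z` when the inversion formula is differentiated.
-/
theorem continuous_iteratedFDeriv_gabor (n : ℕ) (t : E) :
    Continuous (fun z : E × E => iteratedFDeriv ℝ n (gabor z) t) := by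
  set g : (E × E) × E → ℂ := fun p => gabor p.1 p.2
  have h : ∀ z : E × E, iteratedFDeriv ℝ n (gabor z) t =
      (iteratedFDeriv ℝ n g (z, t)).compContinuousLinearMap
        (fun _ => ContinuousLinearMap.inr ℝ (E × E) E) := fun z => by
    have e : gabor z = (fun y => g ((z, 0) + y)) ∘ ContinuousLinearMap.inr ℝ (E × E) E := by
      ext s
      simp [g]
    have hc : ContDiff ℝ (⊤ : ℕ∞) (fun y => g ((z, 0) + y)) :=
      contDiff_gabor_uncurry.comp (contDiff_const.add contDiff_id)
    rw [e, ContinuousLinearMap.iteratedFDeriv_comp_right _ hc t (i := n)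
      (by exact_mod_cast le_top), iteratedFDeriv_comp_add_left]
    simp
  simp only [h]
  exact (ContinuousMultilinearMap.compContinuousLinearMapL
    (fun _ : Fin n => ContinuousLinearMap.inr ℝ (E × E) E)).continuous.comp
    ((contDiff_gabor_uncurry.continuous_iteratedFDeriv
      (by exact_mod_cast le_top)).comp (by fun_prop))

theorem OmegaWeight.exists_norm_gabor_le (ω : OmegaWeight) (l : ℝ) :
    ∃ C, 0 ≤ C ∧ ∀ (z : E × E) t, ‖gabor z t‖ ≤ C * Real.exp (-(l * ω.wt (t - z.1))) := by
  obtain ⟨C, hC, h⟩ := ω.exists_gaussian_le l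
  exact ⟨C, hC, fun z t => (norm_gabor z t).trans_le (h _ (norm_nonneg _))⟩

end GaborEstimates

/-! ### Weighted bounds for atoms and for Gabor transforms. -/

section Decay

variable {ι : Type*} [Fintype ι] (ω : OmegaWeight)

local notation "𝔼" => EuclideanSpace ℝ

theorem exists_weightedDeriv_gabor_le {l : ℝ} (hl : 0 ≤ l) (n : ℕ) :
    ∃ C, 0 ≤ C ∧ ∀ (z : 𝔼 ι × 𝔼 ι) t,
      weightedDeriv ω l n (gabor z) t ≤ C * Real.exp ((l + 1) * ω.wt₂ z) := by
  obtain ⟨C₁, h₁, hC₁⟩ := ω.exists_one_add_pow_le n one_pos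
  -- The Gaussian pays `l` for moving the weight from `t` to `z.1` and one more for the powers of `1
  -- + ‖t - z.1‖`.
  obtain ⟨C₂, h₂, hC₂⟩ := ω.exists_gaussian_le (l + 1)
  refine ⟨n.factorial * C₁ * C₁ * C₂, by positivity, fun z t => ?_⟩
  have ha := norm_nonneg z.2
  have hs := norm_nonneg (t - z.1)
  have hw1 := ω.wt_nonneg z.1
  have hw2 := ω.wt_nonneg z.2
  calc weightedDeriv ω l n (gabor z) t
      ≤ Real.exp (l * ω.wt t) * (n.factorial * Real.exp (-(‖t - z.1‖ ^ 2 / 2)) *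
          (1 + ‖z.2‖ + ‖t - z.1‖) ^ n) := by
        unfold weightedDeriv
        gcongr
        · exact le_rfl
        · exact norm_iteratedFDeriv_gabor_le n z t
    _ ≤ Real.exp (l * (ω.wt z.1 + ω.wt (t - z.1))) *
          (n.factorial * (C₂ * Real.exp (-((l + 1) * ω.wt (t - z.1)))) *
          ((C₁ * Real.exp (1 * ω.wt z.2)) * (C₁ * Real.exp (1 * ω.wt (t - z.1))))) := by
        gcongr
        · exact ω.wt_le_add_sub t z.1
        · exact hC₂ _ hs
        · calc (1 + ‖z.2‖ + ‖t - z.1‖) ^ n ≤ ((1 + ‖z.2‖) * (1 + ‖t - z.1‖)) ^ n := by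
                gcongr
                nlinarith
            _ = (1 + ‖z.2‖) ^ n * (1 + ‖t - z.1‖) ^ n := mul_pow _ _ _
            _ ≤ _ := mul_le_mul (hC₁ _ ha) (hC₁ _ hs) (by positivity) (by positivity)
    _ = n.factorial * C₁ * C₁ * C₂ * Real.exp (l * ω.wt z.1 + ω.wt z.2) := by
        rw [show l * ω.wt z.1 + ω.wt z.2 = l * (ω.wt z.1 + ω.wt (t - z.1)) +
          -((l + 1) * ω.wt (t - z.1)) + 1 * ω.wt z.2 + 1 * ω.wt (t - z.1) by ring]
        simp only [Real.exp_add]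
        ring
    _ ≤ _ := by
        gcongr
        unfold OmegaWeight.wt₂
        nlinarith

/-- The atom is concentrated near `z.1`, so subadditivity transfers the weight from `t` to `z.1`.
Taking the atom at rate `l + 1` leaves an integrable factor. -/
theorem exists_norm_gaborTransform_le_of_decay {l : ℝ} (hl : 0 ≤ l) :
    ∃ C, 0 ≤ C ∧ ∀ (f : 𝔼 ι → ℂ) (N : ℝ), 0 ≤ N →
      (∀ t, ‖f t‖ ≤ N * Real.exp (-(l * ω.wt t))) →
      ∀ z, ‖gaborTransform f z‖ ≤ C * N * Real.exp (-(l * ω.wt z.1)) := by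
  obtain ⟨C, hC, h⟩ := ω.exists_norm_gabor_le (E := 𝔼 ι) (l + 1)
  have hI := ω.integrable_exp_neg_wt (volume : Measure (𝔼 ι)) one_pos
  refine ⟨C * ∫ t : 𝔼 ι, Real.exp (-(1 * ω.wt t)),
    mul_nonneg hC (integral_nonneg fun t => (Real.exp_pos _).le), fun f N hN hf z => ?_⟩
  have hI' := (hI.comp_sub_right z.1).const_mul (C * N * Real.exp (-(l * ω.wt z.1)))
  refine (norm_integral_le_of_norm_le hI' (Eventually.of_forall fun t => ?_)).trans_eq ?_
  · calc ‖f t * gabor z t‖ ≤ N * Real.exp (-(l * ω.wt t)) *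
          (C * Real.exp (-((l + 1) * ω.wt (t - z.1)))) := by
          rw [norm_mul]
          exact mul_le_mul (hf t) (h z t) (norm_nonneg _) (by positivity)
      _ = C * N * Real.exp (-(l * ω.wt t) + -((l + 1) * ω.wt (t - z.1))) := by
          rw [Real.exp_add]; ring
      _ ≤ C * N * Real.exp (-(l * ω.wt z.1) + -(1 * ω.wt (t - z.1))) := by
          refine mul_le_mul_of_nonneg_left (Real.exp_le_exp.2 ?_) (by positivity)
          have := mul_le_mul_of_nonneg_left (ω.wt_le_add_sub z.1 t) hl
          rw [ω.wt_sub_comm z.1 t] at this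
          linarith
      _ = _ := by rw [Real.exp_add]; ring
  · rw [integral_const_mul,
      integral_sub_right_eq_self (fun t : 𝔼 ι => Real.exp (-(1 * ω.wt t))) z.1]
    ring

/-- Decay of `f` controls the position variable and decay of its Fourier transform the frequency
variable. The rates `2 * l` are halved by the geometric mean. No derivatives of `f` or of its
transform are needed. -/
theorem exists_norm_gaborTransform_le {l : ℝ} (hl : 0 ≤ l) :
    ∃ C, 0 ≤ C ∧ ∀ (f : 𝔼 ι → ℂ) (M N : ℝ), Integrable f → 0 ≤ M → 0 ≤ N →
      (∀ t, ‖f t‖ ≤ M * Real.exp (-(2 * l * ω.wt t))) →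
      (∀ t, ‖omegaFourier f t‖ ≤ N * Real.exp (-(2 * l * ω.wt t))) →
      ∀ z, ‖gaborTransform f z‖ ≤ C * (M + N) * Real.exp (-(l * ω.wt₂ z)) := by
  obtain ⟨C, hC, h⟩ := exists_norm_gaborTransform_le_of_decay (ι := ι) ω
    (by positivity : 0 ≤ 2 * l)
  set G := ‖(gaussianConst ι)⁻¹‖
  have hG : 0 ≤ G := norm_nonneg _
  refine ⟨C * (1 + G), by positivity, fun f M N hfi hM hN hf hF z => ?_⟩
  have h1 := h f M hM hf z
  have h2 : ‖gaborTransform f z‖ ≤ G * C * N * Real.exp (-(2 * l * ω.wt z.2)) := by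
    rw [gaborTransform_eq_omegaFourier hfi, norm_mul, norm_mul, norm_exp_I_inner, mul_one]
    refine (mul_le_mul_of_nonneg_left (h _ N hN hF _) hG).trans_eq ?_
    rw [ω.wt_neg]
    ring
  refine (le_exp_of_le_of_le (by positivity) (by positivity) h1 h2).trans ?_
  refine mul_le_mul ?_ (le_of_eq ?_) (by positivity) (by positivity)
  · nlinarith [mul_nonneg hC hM, mul_nonneg hC hN, mul_nonneg (mul_nonneg hC hM) hG]
  · congr 1
    unfold OmegaWeight.wt₂
    ring

theorem stronglyMeasurable_gaborTransform {f : 𝔼 ι → ℂ} (hf : Continuous f) :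
    StronglyMeasurable (gaborTransform f) :=
  StronglyMeasurable.integral_prod_right'
    (f := fun p : (𝔼 ι × 𝔼 ι) × 𝔼 ι => f p.2 * gabor p.1 p.2)
    ((hf.comp continuous_snd).mul continuous_gabor).stronglyMeasurable

/-- Bounded continuous functions whose Gabor transform is `O(e^{-l ω})` for all `l`. -/
structure GaborDecay (f : 𝔼 ι → ℂ) : Prop where
  continuous : Continuous f
  bounded : ∃ A, ∀ t, ‖f t‖ ≤ A
  decay : ∀ l, 0 < l → ∃ N, ∀ z, ‖gaborTransform f z‖ ≤ N * Real.exp (-(l * ω.wt₂ z))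

end Decay

/-! ### From decay of the Gabor transform back to `𝓢_ω`. -/

section GaborDecay

variable {ι : Type*} [Fintype ι] {ω : OmegaWeight}

local notation "𝔼" => EuclideanSpace ℝ

namespace GaborDecay

variable {f : 𝔼 ι → ℂ}

theorem integrable_mul_exp (hf : GaborDecay ω f) (l : ℝ) :
    Integrable (fun z => ‖gaborTransform f z‖ * Real.exp (l * ω.wt₂ z)) := by
  obtain ⟨N, hN⟩ := hf.decay (|l| + 1) (by positivity)
  have hI := (ω.integrable_exp_neg_wt₂ (volume : Measure (𝔼 ι)) one_pos).const_mul N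
  refine hI.mono' ?_ (Eventually.of_forall fun z => ?_)
  · exact (stronglyMeasurable_gaborTransform hf.continuous).aestronglyMeasurable.norm.mul
      (Real.continuous_exp.comp (ω.continuous_wt₂.const_mul l)).aestronglyMeasurable
  · have hN0 : 0 ≤ N := by
      by_contra h
      exact absurd ((norm_nonneg _).trans (hN 0)) (not_le.2 (mul_neg_of_neg_of_pos (not_le.1 h)
        (Real.exp_pos _)))
    rw [Real.norm_of_nonneg (by positivity)]
    calc _ ≤ N * Real.exp (-((|l| + 1) * ω.wt₂ z)) * Real.exp (l * ω.wt₂ z) := by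
          gcongr; exact hN z
      _ = N * Real.exp (-((|l| + 1) * ω.wt₂ z) + l * ω.wt₂ z) := by rw [Real.exp_add]; ring
      _ ≤ _ := by
          refine mul_le_mul_of_nonneg_left (Real.exp_le_exp.2 ?_) hN0
          nlinarith [le_abs_self l, ω.wt₂_nonneg z]

theorem integrable_gaborTransform (hf : GaborDecay ω f) : Integrable (gaborTransform f) := by
  rw [← integrable_norm_iff
    (stronglyMeasurable_gaborTransform hf.continuous).aestronglyMeasurable]
  simpa using hf.integrable_mul_exp 0

theorem inversion (hf : GaborDecay ω f) (t : 𝔼 ι) :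
    f t = gaborConst ι * ∫ z, gaborTransform f z * gabor (z.1, -z.2) t := by
  obtain ⟨A, hA⟩ := hf.bounded
  refine gaborTransform_inversion hf.continuous hA hf.integrable_gaborTransform (fun x => ?_) t
  obtain ⟨N, hN⟩ := hf.decay 1 one_pos
  have hI := (ω.integrable_exp_neg_wt (volume : Measure (𝔼 ι)) one_pos).const_mul N
  refine hI.mono' ((stronglyMeasurable_gaborTransform hf.continuous).comp_measurable
    measurable_prodMk_left).aestronglyMeasurable (Eventually.of_forall fun ξ => ?_)
  refine (hN (x, ξ)).trans ?_
  have hN0 : 0 ≤ N := by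
    by_contra h
    exact absurd ((norm_nonneg _).trans (hN 0)) (not_le.2 (mul_neg_of_neg_of_pos (not_le.1 h)
      (Real.exp_pos _)))
  refine mul_le_mul_of_nonneg_left (Real.exp_le_exp.2 ?_) hN0
  have := ω.wt_nonneg x
  simp only [OmegaWeight.wt₂]
  linarith

/-- The inversion formula is differentiated under the integral, each atom costing at most
`e^{(l+1)ω}`. The constant is chosen before `f`, so the bound serves as a seminorm estimate. -/
theorem contDiff_and_bound (ω : OmegaWeight) {l : ℝ} (hl : 0 ≤ l) (n : ℕ) :
    ∃ C, 0 ≤ C ∧ ∀ f : 𝔼 ι → ℂ, GaborDecay ω f → ContDiff ℝ (⊤ : ℕ∞) f ∧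
      ∀ t, weightedDeriv ω l n f t ≤
        C * ∫ z, ‖gaborTransform f z‖ * Real.exp ((l + 1) * ω.wt₂ z) := by
  -- These bounds carry no weight in `t` and serve only as majorants for differentiation.
  choose! D hD0 hD using fun m => exists_weightedDeriv_gabor_le (ι := ι) ω le_rfl m
  obtain ⟨C, hC, h⟩ := exists_weightedDeriv_gabor_le (ι := ι) ω hl n
  refine ⟨‖gaborConst ι‖ * C, by positivity, fun f hf => ?_⟩
  set κ : 𝔼 ι × 𝔼 ι → 𝔼 ι → ℂ := fun z => gaborTransform f z • gabor (z.1, -z.2) with hκdef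
  have hκ : ∀ n z t, iteratedFDeriv ℝ n (κ z) t =
      gaborTransform f z • iteratedFDeriv ℝ n (gabor (z.1, -z.2)) t := fun n z t =>
    iteratedFDeriv_const_smul_apply (contDiff_gabor n _).contDiffAt
  have hw : ∀ z : 𝔼 ι × 𝔼 ι, ω.wt₂ (z.1, -z.2) = ω.wt₂ z := fun z => by
    simp only [OmegaWeight.wt₂, ω.wt_neg]
  have hflip : Continuous fun z : 𝔼 ι × 𝔼 ι => (z.1, -z.2) := by fun_prop
  have hfe : f = fun t => gaborConst ι • ∫ z, κ z t := by
    ext t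
    exact hf.inversion t
  obtain ⟨hcd, hder⟩ := iteratedFDeriv_integral (κ := κ) (μ := volume)
    (B := fun n z => ‖gaborTransform f z‖ * (D n * Real.exp ((0 + 1) * ω.wt₂ z)))
    (fun z => (contDiff_gabor (⊤ : ℕ∞) (z.1, -z.2)).const_smul (gaborTransform f z))
    (fun n t => by
      simp only [hκ]
      exact (stronglyMeasurable_gaborTransform hf.continuous).aestronglyMeasurable.smul
        ((continuous_iteratedFDeriv_gabor n t).comp hflip).aestronglyMeasurable)
    (fun n => ((hf.integrable_mul_exp (0 + 1)).const_mul (D n)).congr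
      (Eventually.of_forall fun z => by ring))
    (fun n z t => by
      rw [hκ, norm_smul]
      have := hD n (z.1, -z.2) t
      rw [weightedDeriv, zero_mul, Real.exp_zero, one_mul, hw] at this
      gcongr)
  refine ⟨?_, fun t => ?_⟩
  · rw [hfe]
    exact hcd.const_smul _
  · have h1 : iteratedFDeriv ℝ n f t = gaborConst ι • ∫ z, iteratedFDeriv ℝ n (κ z) t := by
      rw [← hder, hfe]
      exact iteratedFDeriv_const_smul_apply (a := gaborConst ι)
        ((hcd.contDiffAt (x := t)).of_le (by exact_mod_cast le_top))
    rw [weightedDeriv, h1, norm_smul, mul_left_comm, mul_assoc, ← integral_const_mul]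
    refine mul_le_mul_of_nonneg_left ?_ (norm_nonneg _)
    rw [← norm_smul_of_nonneg (Real.exp_pos _).le, ← integral_smul]
    refine norm_integral_le_of_norm_le ((hf.integrable_mul_exp (l + 1)).const_mul C)
      (Eventually.of_forall fun z => ?_)
    have := h (z.1, -z.2) t
    rw [weightedDeriv, hw] at this
    rw [hκ, norm_smul_of_nonneg (Real.exp_pos _).le, norm_smul, mul_left_comm]
    refine (mul_le_mul_of_nonneg_left this (norm_nonneg _)).trans_eq ?_
    ring

theorem exists_schwartz (hf : GaborDecay ω f) :
    ∃ F : 𝓢(𝔼 ι, ℂ), (F : 𝔼 ι → ℂ) = f ∧ F ∈ omegaDecaySubmodule ω ι := by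
  have hb : ∀ l, 0 < l → ∀ n, ∃ A, ∀ x, weightedDeriv ω l n f x ≤ A := fun l hl n => by
    obtain ⟨C, -, h⟩ := contDiff_and_bound (ι := ι) ω hl.le n
    exact ⟨_, (h f hf).2⟩
  obtain ⟨_, -, h0⟩ := contDiff_and_bound (ι := ι) ω le_rfl 0
  refine ⟨⟨f, (h0 f hf).1, fun k n => ?_⟩, rfl, fun l hl n => ?_⟩
  · obtain ⟨A, hA⟩ := hb 1 one_pos n
    obtain ⟨C, hC, h⟩ := ω.exists_one_add_pow_le k one_pos
    refine ⟨C * A, fun x => ?_⟩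
    calc ‖x‖ ^ k * ‖iteratedFDeriv ℝ n f x‖
        ≤ (1 + ‖x‖) ^ k * ‖iteratedFDeriv ℝ n f x‖ := by gcongr; linarith
      _ ≤ C * Real.exp (1 * ω.toFun ‖x‖) * ‖iteratedFDeriv ℝ n f x‖ := by
        gcongr; exact h _ (norm_nonneg x)
      _ = C * weightedDeriv ω 1 n f x := by rw [weightedDeriv, mul_assoc]
      _ ≤ C * A := by gcongr; exact hA x
  · obtain ⟨A, hA⟩ := hb l hl n
    exact ⟨A, by rintro _ ⟨x, rfl⟩; exact hA x⟩

theorem gaborTransform_omegaFourier (hf : Integrable f) (z : 𝔼 ι × 𝔼 ι) :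
    ‖gaborTransform (omegaFourier f) z‖ =
      ‖gaussianConst ι‖ * ‖gaborTransform f (z.2, -z.1)‖ := by
  have h := gaborTransform_eq_omegaFourier hf (z.2, -z.1)
  rw [h, norm_mul, norm_mul, norm_exp_I_inner, mul_one, norm_inv, neg_neg,
    mul_inv_cancel_left₀ (norm_ne_zero_iff.2 gaussianConst_ne_zero)]

theorem wt₂_rotate (z : 𝔼 ι × 𝔼 ι) : ω.wt₂ (z.2, -z.1) = ω.wt₂ z := by
  simp only [OmegaWeight.wt₂, ω.wt_neg, add_comm]

/-- The Fourier transform rotates the Gabor transform, and the phase-space weight is invariant under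
this rotation. -/
theorem omegaFourier (hf : GaborDecay ω f) : GaborDecay ω (omegaFourier f) := by
  obtain ⟨F, rfl, -⟩ := hf.exists_schwartz
  refine ⟨(schwartzFourier ι F).continuous, ?_, fun l hl => ?_⟩
  · obtain ⟨C, hC⟩ := (schwartzFourier ι F).decay' 0 0
    refine ⟨C, fun t => ?_⟩
    have h := hC t
    rw [pow_zero, one_mul, norm_iteratedFDeriv_zero] at h
    exact h
  · obtain ⟨N, hN⟩ := hf.decay l hl
    refine ⟨‖gaussianConst ι‖ * N, fun z => ?_⟩
    rw [gaborTransform_omegaFourier F.integrable, mul_assoc, ← wt₂_rotate]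
    exact mul_le_mul_of_nonneg_left (hN _) (norm_nonneg _)

theorem exists_omegaSchwartz (hf : GaborDecay ω f) :
    ∃ g : OmegaSchwartz ω ι, (g : 𝔼 ι → ℂ) = f := by
  obtain ⟨F, rfl, hF⟩ := hf.exists_schwartz
  obtain ⟨G, hG, hG'⟩ := hf.omegaFourier.exists_schwartz
  have : schwartzFourier ι F = G := by
    ext t
    rw [hG]
    rfl
  exact ⟨⟨F, hF, (congrArg (· ∈ omegaDecaySubmodule ω ι) this).mpr hG'⟩, rfl⟩

end GaborDecay

end GaborDecay

/-! ### The topology of `𝓢_ω` in terms of the Gabor transform. -/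

namespace OmegaSchwartz

variable {ι κ : Type*} [Fintype ι] [Fintype κ] {ω : OmegaWeight}

local notation "𝔼" => EuclideanSpace ℝ

theorem continuous (f : OmegaSchwartz ω ι) : Continuous (f : 𝔼 ι → ℂ) :=
  (toSchwartz ω ι f).continuous

theorem integrable (f : OmegaSchwartz ω ι) : Integrable (f : 𝔼 ι → ℂ) :=
  (toSchwartz ω ι f).integrable

theorem ext {f g : OmegaSchwartz ω ι} (h : ∀ x, f x = g x) : f = g :=
  Subtype.ext (DFunLike.ext _ _ h)

theorem norm_le_seminorm {l : ℝ} (hl : 0 < l) (f : OmegaSchwartz ω ι) (x : 𝔼 ι) :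
    ‖f x‖ ≤ seminormFamily ω ι (Sum.inl (⟨l, hl⟩, 0)) f * Real.exp (-(l * ω.wt x)) := by
  have h : weightedDeriv ω l 0 f x ≤ seminormFamily ω ι (Sum.inl (⟨l, hl⟩, 0)) f :=
    le_ciSup (mem_decay f l hl 0) x
  rw [weightedDeriv, norm_iteratedFDeriv_zero] at h
  rw [Real.exp_neg, ← div_eq_mul_inv, le_div_iff₀ (Real.exp_pos _), mul_comm]
  exact h

theorem norm_omegaFourier_le_seminorm {l : ℝ} (hl : 0 < l) (f : OmegaSchwartz ω ι) (x : 𝔼 ι) :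
    ‖omegaFourier f x‖ ≤
      seminormFamily ω ι (Sum.inr (⟨l, hl⟩, 0)) f * Real.exp (-(l * ω.wt x)) := by
  have h : weightedDeriv ω l 0 (omegaFourier f) x ≤
      seminormFamily ω ι (Sum.inr (⟨l, hl⟩, 0)) f :=
    le_ciSup (fourier_mem_decay f l hl 0) x
  rw [weightedDeriv, norm_iteratedFDeriv_zero] at h
  rw [Real.exp_neg, ← div_eq_mul_inv, le_div_iff₀ (Real.exp_pos _), mul_comm]
  exact h

theorem exists_seminorm_gaborTransform_le (ω : OmegaWeight) (ι : Type*) [Fintype ι] (l : ℝ) :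
    ∃ q : Seminorm ℂ (OmegaSchwartz ω ι), Continuous q ∧ ∀ (f : OmegaSchwartz ω ι) z,
      ‖gaborTransform f z‖ ≤ q f * Real.exp (-(l * ω.wt₂ z)) := by
  -- A positive rate at least `l`, so that `l` itself may have any sign.
  set m := |l| + 1
  have hm : 0 < 2 * m := by positivity
  obtain ⟨C, hC, h⟩ := exists_norm_gaborTransform_le (ι := ι) ω (by positivity : 0 ≤ m)
  set p := seminormFamily ω ι (Sum.inl (⟨2 * m, hm⟩, 0)) + seminormFamily ω ι (Sum.inr (⟨2 * m, hm⟩, 0))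
  have hp : Continuous p := ((withSeminorms ω ι).continuous_seminorm _).add
    ((withSeminorms ω ι).continuous_seminorm _)
  let c : NNReal := ⟨C, hC⟩
  refine ⟨c • p, continuous_const.mul hp, fun f z => ?_⟩
  refine (h f _ _ f.integrable (apply_nonneg _ f) (apply_nonneg _ f)
    (f.norm_le_seminorm hm) (f.norm_omegaFourier_le_seminorm hm) z).trans ?_
  change C * p f * _ ≤ C * p f * _
  refine mul_le_mul_of_nonneg_left (Real.exp_le_exp.2 ?_) (mul_nonneg hC (apply_nonneg _ f))
  nlinarith [le_abs_self l, ω.wt₂_nonneg z]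

theorem gaborDecay (f : OmegaSchwartz ω ι) : GaborDecay ω f :=
  ⟨f.continuous, ⟨_, f.norm_apply_le⟩, fun l _ => by
    obtain ⟨q, -, hq⟩ := exists_seminorm_gaborTransform_le ω ι l
    exact ⟨q f, hq f⟩⟩

theorem integral_rotate (F : 𝔼 ι × 𝔼 ι → ℝ) : ∫ z : 𝔼 ι × 𝔼 ι, F (z.2, -z.1) = ∫ z, F z := by
  rw [Measure.volume_eq_prod]
  have h1 := integral_prod_swap (μ := (volume : Measure (𝔼 ι))) (ν := (volume : Measure (𝔼 ι)))
    (fun z => F (z.1, -z.2))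
  have h2 := ((MeasurePreserving.id (volume : Measure (𝔼 ι))).prod
    (Measure.measurePreserving_neg (volume : Measure (𝔼 ι)))).integral_comp
    ((Homeomorph.refl (𝔼 ι)).prodCongr (Homeomorph.neg (𝔼 ι))).measurableEmbedding F
  exact h1.trans h2

/-- Converse of `exists_seminorm_gaborTransform_le`. Seminorms of the Fourier transform need no
separate argument, since the quarter turn preserves both Lebesgue measure and the weight. -/
theorem exists_seminormFamily_le (ω : OmegaWeight) (ι : Type*) [Fintype ι]
    (i : (Ioi (0 : ℝ) × ℕ) ⊕ (Ioi (0 : ℝ) × ℕ)) :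
    ∃ C l : ℝ, 0 ≤ C ∧ ∀ f : OmegaSchwartz ω ι, seminormFamily ω ι i f ≤
      C * ∫ z, ‖gaborTransform f z‖ * Real.exp (l * ω.wt₂ z) := by
  rcases i with ⟨⟨l, hl⟩, n⟩ | ⟨⟨l, hl⟩, n⟩
  · obtain ⟨C, hC, h⟩ := GaborDecay.contDiff_and_bound (ι := ι) ω (le_of_lt hl) n
    exact ⟨C, l + 1, hC, fun f => ciSup_le (h f f.gaborDecay).2⟩
  · obtain ⟨C, hC, h⟩ := GaborDecay.contDiff_and_bound (ι := ι) ω (le_of_lt hl) n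
    refine ⟨C * ‖gaussianConst ι‖, l + 1, by positivity, fun f => ?_⟩
    refine (ciSup_le (h _ f.gaborDecay.omegaFourier).2).trans_eq ?_
    rw [← integral_rotate (fun z => ‖gaborTransform f z‖ * Real.exp ((l + 1) * ω.wt₂ z)),
      mul_assoc, ← integral_const_mul ‖gaussianConst ι‖]
    refine congrArg (C * ·) (integral_congr_ae (Eventually.of_forall fun z => ?_))
    dsimp only
    rw [GaborDecay.gaborTransform_omegaFourier f.integrable, GaborDecay.wt₂_rotate, mul_assoc]

theorem continuous_of_gaborTransform_le (L : OmegaSchwartz ω ι →ₗ[ℂ] OmegaSchwartz ω κ)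
    (h : ∀ l, 0 < l → ∃ q : Seminorm ℂ (OmegaSchwartz ω ι), Continuous q ∧ ∀ f z,
      ‖gaborTransform (L f) z‖ ≤ q f * Real.exp (-(l * ω.wt₂ z))) : Continuous L := by
  refine (withSeminorms ω κ).continuous_of_continuous_comp L fun i => ?_
  obtain ⟨C, l, hC, hi⟩ := exists_seminormFamily_le ω κ i
  -- The rate exceeds `l` by at least one, which leaves the integrable factor whose integral is `I`.
  obtain ⟨q, hq, hL⟩ := h (|l| + 1) (by positivity)
  set I := ∫ z : 𝔼 κ × 𝔼 κ, Real.exp (-(1 * ω.wt₂ z))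
  have hI : 0 ≤ I := integral_nonneg fun _ => (Real.exp_pos _).le
  let c : NNReal := ⟨C * I, mul_nonneg hC hI⟩
  have hq' : Continuous (c • q) := continuous_const.mul hq
  refine Seminorm.continuous_of_le hq' fun f => ?_
  change seminormFamily ω κ i (L f) ≤ C * I * q f
  refine (hi (L f)).trans ?_
  rw [mul_assoc, mul_comm I, ← integral_const_mul (q f)]
  refine mul_le_mul_of_nonneg_left ?_ hC
  refine integral_mono ((L f).gaborDecay.integrable_mul_exp l)
    ((ω.integrable_exp_neg_wt₂ _ one_pos).const_mul _) fun z => ?_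
  have hexp : Real.exp (-((|l| + 1) * ω.wt₂ z)) * Real.exp (l * ω.wt₂ z) ≤
      Real.exp (-(1 * ω.wt₂ z)) := by
    rw [← Real.exp_add, Real.exp_le_exp]
    nlinarith [le_abs_self l, ω.wt₂_nonneg z]
  calc _ ≤ q f * Real.exp (-((|l| + 1) * ω.wt₂ z)) * Real.exp (l * ω.wt₂ z) :=
        mul_le_mul_of_nonneg_right (hL f z) (Real.exp_pos _).le
    _ = q f * (Real.exp (-((|l| + 1) * ω.wt₂ z)) * Real.exp (l * ω.wt₂ z)) := mul_assoc _ _ _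
    _ ≤ _ := mul_le_mul_of_nonneg_left hexp (apply_nonneg q f)

end OmegaSchwartz

/-! ### Distributions as weighted densities on phase space. -/

section Representation

variable {ι : Type*} [Fintype ι] {ω : OmegaWeight}

local notation "𝔼" => EuclideanSpace ℝ

theorem gaborTransform_add {f g : 𝔼 ι → ℂ} {z : 𝔼 ι × 𝔼 ι} (hf : Integrable f) (hg : Integrable g) :
    gaborTransform (f + g) z = gaborTransform f z + gaborTransform g z := by
  have hb : ∀ f : 𝔼 ι → ℂ, Integrable f → Integrable (fun t => f t * gabor z t) := fun f hf =>
    hf.mul_bdd (c := 1) (contDiff_gabor 0 z).continuous.aestronglyMeasurable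
      (Eventually.of_forall (norm_gabor_le_one z))
  rw [gaborTransform, gaborTransform, gaborTransform, ← integral_add (hb f hf) (hb g hg)]
  simp only [Pi.add_apply, add_mul]

theorem gaborTransform_smul (c : ℂ) (f : 𝔼 ι → ℂ) (z : 𝔼 ι × 𝔼 ι) :
    gaborTransform (c • f) z = c * gaborTransform f z := by
  rw [gaborTransform, gaborTransform, ← integral_const_mul]
  simp only [Pi.smul_apply, smul_eq_mul, mul_assoc]

theorem exists_finset_sup_seminormFamily_le (ω : OmegaWeight) (ι : Type*) [Fintype ι]
    (s : Finset ((Ioi (0 : ℝ) × ℕ) ⊕ (Ioi (0 : ℝ) × ℕ))) :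
    ∃ C l : ℝ, 0 ≤ C ∧ ∀ f : OmegaSchwartz ω ι, s.sup (OmegaSchwartz.seminormFamily ω ι) f ≤
      C * ∫ z, ‖gaborTransform f z‖ * Real.exp (l * ω.wt₂ z) := by
  classical
  induction s using Finset.induction_on with
  | empty => exact ⟨0, 0, le_rfl, fun f => by simp⟩
  | insert i s _ ih =>
    obtain ⟨C₁, l₁, h₁, hC₁⟩ := OmegaSchwartz.exists_seminormFamily_le ω ι i
    obtain ⟨C₂, l₂, h₂, hC₂⟩ := ih
    have hmono : ∀ (f : OmegaSchwartz ω ι) {l m : ℝ}, l ≤ m →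
        ∫ z, ‖gaborTransform f z‖ * Real.exp (l * ω.wt₂ z) ≤
          ∫ z, ‖gaborTransform f z‖ * Real.exp (m * ω.wt₂ z) := fun f l m hlm =>
      integral_mono (f.gaborDecay.integrable_mul_exp l) (f.gaborDecay.integrable_mul_exp m)
        fun z => mul_le_mul_of_nonneg_left (Real.exp_le_exp.2
          (mul_le_mul_of_nonneg_right hlm (ω.wt₂_nonneg z))) (norm_nonneg _)
    refine ⟨C₁ + C₂, max l₁ l₂, by positivity, fun f => ?_⟩
    have hI : 0 ≤ ∫ z, ‖gaborTransform f z‖ * Real.exp (max l₁ l₂ * ω.wt₂ z) :=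
      integral_nonneg fun z => by positivity
    rw [Finset.sup_insert, Seminorm.sup_apply]
    refine max_le ?_ ?_
    · refine (hC₁ f).trans ?_
      have := mul_le_mul_of_nonneg_left (hmono f (le_max_left l₁ l₂)) h₁
      nlinarith [mul_nonneg h₂ hI]
    · refine (hC₂ f).trans ?_
      have := mul_le_mul_of_nonneg_left (hmono f (le_max_right l₁ l₂)) h₂
      nlinarith [mul_nonneg h₁ hI]

theorem exists_norm_apply_le (u : OmegaDistribution ω ι) :
    ∃ C l : ℝ, 0 ≤ C ∧ ∀ f : OmegaSchwartz ω ι,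
      ‖u f‖ ≤ C * ∫ z, ‖gaborTransform f z‖ * Real.exp (l * ω.wt₂ z) := by
  obtain ⟨s, A, -, hA⟩ := Seminorm.bound_of_continuous (OmegaSchwartz.withSeminorms ω ι)
    ((normSeminorm ℂ ℂ).comp u.toLinearMap) (continuous_norm.comp u.continuous)
  obtain ⟨C, l, hC, h⟩ := exists_finset_sup_seminormFamily_le ω ι s
  refine ⟨A * C, l, by positivity, fun f => (hA f).trans ?_⟩
  change (A : ℝ) * _ ≤ _
  rw [mul_assoc]
  exact mul_le_mul_of_nonneg_left (h f) A.coe_nonneg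

theorem memLp_exp_neg_wt₂ {l : ℝ} (hl : 0 < l) :
    MemLp (fun z : 𝔼 ι × 𝔼 ι => Real.exp (-(l * ω.wt₂ z))) 2 := by
  have hm : AEStronglyMeasurable (fun z : 𝔼 ι × 𝔼 ι => Real.exp (-(l * ω.wt₂ z))) volume :=
    (Real.continuous_exp.comp (ω.continuous_wt₂.const_mul l).neg).aestronglyMeasurable
  refine (memLp_two_iff_integrable_sq hm).2 ((ω.integrable_exp_neg_wt₂ (volume : Measure (𝔼 ι)) (by positivity : 0 < 2 * l)).congr
    (Eventually.of_forall fun z => ?_))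
  simp only [← Real.exp_nat_mul]
  congr 1
  push_cast
  ring

theorem memLp_exp_mul_gaborTransform (l : ℝ) (g : OmegaSchwartz ω ι) :
    MemLp (fun z => (Real.exp (l * ω.wt₂ z) : ℂ) * gaborTransform g z) 2 := by
  obtain ⟨q, -, hq⟩ := OmegaSchwartz.exists_seminorm_gaborTransform_le ω ι (l + 1)
  refine ((memLp_exp_neg_wt₂ (ω := ω) (ι := ι) one_pos).const_mul (q g)).mono'
    ?_ (Eventually.of_forall fun z => ?_)
  · exact ((Complex.continuous_ofReal.comp (Real.continuous_exp.comp
      (ω.continuous_wt₂.const_mul l))).aestronglyMeasurable).mul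
      (stronglyMeasurable_gaborTransform g.continuous).aestronglyMeasurable
  · rw [norm_mul, Complex.norm_real, Real.norm_of_nonneg (Real.exp_pos _).le]
    refine (mul_le_mul_of_nonneg_left (hq g z) (Real.exp_pos _).le).trans_eq ?_
    rw [mul_left_comm, ← Real.exp_add]
    congr 2
    ring

/-- The weighted Gabor transform as a linear map to `L²`. -/
noncomputable def gaborToLp (ω : OmegaWeight) (ι : Type*) [Fintype ι] (l : ℝ) :
    OmegaSchwartz ω ι →ₗ[ℂ] Lp ℂ 2 (volume : Measure (𝔼 ι × 𝔼 ι)) where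
  toFun g := (memLp_exp_mul_gaborTransform l g).toLp _
  map_add' f g := by
    rw [← MemLp.toLp_add]
    congr 1
    ext z
    have : ((f + g : OmegaSchwartz ω ι) : 𝔼 ι → ℂ) = (f : 𝔼 ι → ℂ) + g := rfl
    rw [Pi.add_apply, ← mul_add, this, gaborTransform_add f.integrable g.integrable]
  map_smul' c g := by
    rw [RingHom.id_apply, ← MemLp.toLp_const_smul]
    congr 1
    ext z
    have : ((c • g : OmegaSchwartz ω ι) : 𝔼 ι → ℂ) = c • (g : 𝔼 ι → ℂ) := rfl
    rw [Pi.smul_apply, smul_eq_mul, this, gaborTransform_smul, mul_left_comm]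

theorem integral_mul_norm_le_norm_toLp {α : Type*} [MeasurableSpace α] {μ : Measure α}
    {φ : α → ℝ} {F : α → ℂ} (hφ : MemLp φ 2 μ) (hF : MemLp F 2 μ) :
    ∫ z, φ z * ‖F z‖ ∂μ ≤ ‖hφ.toLp φ‖ * ‖hF.toLp F‖ := by
  have h := real_inner_le_norm (hF.norm.toLp _) (hφ.toLp φ)
  rw [L2.inner_def] at h
  have e : ‖hF.norm.toLp _‖ = ‖hF.toLp F‖ := by
    rw [Lp.norm_toLp, Lp.norm_toLp, eLpNorm_norm]
  rw [e, mul_comm] at h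
  refine le_trans (le_of_eq (integral_congr_ae ?_)) h
  filter_upwards [hF.norm.coeFn_toLp, hφ.coeFn_toLp] with z h1 h2
  rw [h1, h2]
  rfl

/-- The seminorms of `𝓢_ω` are dominated by weighted `L²` norms of the Gabor transform, so every
`ω`-tempered distribution is a superposition of values of the Gabor transform. -/
theorem exists_representation (u : OmegaDistribution ω ι) :
    ∃ (U : 𝔼 ι × 𝔼 ι → ℂ) (l : ℝ), AEStronglyMeasurable U ∧
      Integrable (fun z => ‖U z‖ * Real.exp (-(l * ω.wt₂ z))) ∧
      ∀ g : OmegaSchwartz ω ι, u g = ∫ z, U z * gaborTransform g z := by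
  obtain ⟨C, l, hC, hu⟩ := exists_norm_apply_le u
  -- One unit more than `l`: by Cauchy–Schwarz the spare `e^{-ω}`, which lies in `L²`, turns the
  -- weighted `L¹` bound for `u` into an `L²` bound.
  set J := gaborToLp ω ι (l + 1) with hJdef
  have hφ := memLp_exp_neg_wt₂ (ω := ω) (ι := ι) one_pos
  have hJu : ∀ g, ‖u g‖ ≤ C * ‖hφ.toLp _‖ * ‖J g‖ := fun g => by
    refine (hu g).trans ?_
    rw [mul_assoc]
    refine mul_le_mul_of_nonneg_left (le_trans (le_of_eq ?_)
      (integral_mul_norm_le_norm_toLp hφ (memLp_exp_mul_gaborTransform (l + 1) g))) hC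
    congr 1
    ext z
    rw [norm_mul, Complex.norm_real, Real.norm_of_nonneg (Real.exp_pos _).le, ← mul_assoc,
      ← Real.exp_add, mul_comm]
    congr 2
    ring
  -- `u` factors through `J`, since `hJu` makes it vanish on the kernel of `J`. Any linear section
  -- `R` therefore defines the same bounded functional on the range.
  obtain ⟨R, hR⟩ := J.rangeRestrict.exists_rightInverse_of_surjective
    (LinearMap.range_rangeRestrict J)
  have hR' : ∀ y : LinearMap.range J, J (R y) = y := fun y =>
    congrArg Subtype.val (LinearMap.congr_fun hR y)
  let v : LinearMap.range J →L[ℂ] ℂ := (u.toLinearMap ∘ₗ R).mkContinuous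
    (C * ‖hφ.toLp _‖) fun y => (hJu (R y)).trans_eq (by rw [hR']; rfl)
  obtain ⟨w, hw, -⟩ := exists_extension_norm_eq (LinearMap.range J) v
  set h := (InnerProductSpace.toDual ℂ _).symm w with hh
  have huw : ∀ g, u g = inner ℂ h (J g) := fun g => by
    rw [hh, InnerProductSpace.toDual_symm_apply]
    have h1 := hw ⟨J g, LinearMap.mem_range_self J g⟩
    rw [h1]
    change u g = u (R _)
    have h2 := hJu (g - R ⟨J g, LinearMap.mem_range_self J g⟩)
    rw [map_sub, map_sub, hR', sub_self, norm_zero, mul_zero] at h2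
    exact sub_eq_zero.1 (norm_le_zero_iff.1 h2)
  have hexp : Continuous fun z : 𝔼 ι × 𝔼 ι => (Real.exp ((l + 1) * ω.wt₂ z) : ℂ) :=
    Complex.continuous_ofReal.comp (Real.continuous_exp.comp (ω.continuous_wt₂.const_mul _))
  -- The conjugate undoes the antilinear first slot of the inner product. A further unit in the
  -- weight, `l + 2`, passes from `L²` back to `L¹`.
  refine ⟨fun z => (starRingEnd ℂ) (h z) * (Real.exp ((l + 1) * ω.wt₂ z) : ℂ), l + 2, ?_, ?_, ?_⟩
  · exact (Complex.continuous_conj.comp_aestronglyMeasurable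
      (Lp.aestronglyMeasurable h)).mul hexp.aestronglyMeasurable
  · refine ((Lp.memLp h).norm.integrable_mul hφ).congr (Eventually.of_forall fun z => ?_)
    simp only [Pi.mul_apply]
    rw [norm_mul, RCLike.norm_conj, Complex.norm_real, Real.norm_of_nonneg (Real.exp_pos _).le,
      mul_assoc, ← Real.exp_add]
    congr 2
    ring
  · intro g
    rw [huw, L2.inner_def]
    refine integral_congr_ae ?_
    filter_upwards [(memLp_exp_mul_gaborTransform (l + 1) g).coeFn_toLp] with z hz
    have : (J g : 𝔼 ι × 𝔼 ι → ℂ) z = (Real.exp ((l + 1) * ω.wt₂ z) : ℂ) * gaborTransform g z := hz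
    rw [this, RCLike.inner_apply]
    ring

end Representation

/-! ### Superpositions of functions and density of `𝓢_ω` in `𝓢'_ω`. -/

section Superposition

variable {ι : Type*} [Fintype ι] {ω : OmegaWeight}

local notation "𝔼" => EuclideanSpace ℝ

theorem integral_superposition_mul {U : 𝔼 ι × 𝔼 ι → ℂ} {k : 𝔼 ι × 𝔼 ι → 𝔼 ι → ℂ}
    {h : 𝔼 ι × 𝔼 ι → ℝ} (hU : AEStronglyMeasurable U)
    (hk : Continuous fun p : (𝔼 ι × 𝔼 ι) × 𝔼 ι => k p.1 p.2) (hh : Integrable h)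
    (hb : ∀ z t, ‖U z * k z t‖ ≤ h z) {g : 𝔼 ι → ℂ} (hg : Integrable g) :
    ∫ t, (∫ z, U z * k z t) * g t = ∫ z, U z * ∫ t, k z t * g t := by
  simp only [← integral_mul_const, ← integral_const_mul]
  rw [integral_integral_swap]
  · simp only [mul_assoc]
  · have hm : AEStronglyMeasurable (fun p : 𝔼 ι × (𝔼 ι × 𝔼 ι) => U p.2 * k p.2 p.1 * g p.1)
        (volume.prod volume) :=
      (hU.comp_snd.mul (hk.comp continuous_swap).aestronglyMeasurable).mul
        hg.aestronglyMeasurable.comp_fst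
    refine (hg.norm.mul_prod hh).mono' hm (Eventually.of_forall fun p => ?_)
    simp only [Function.uncurry]
    rw [norm_mul, mul_comm]
    exact mul_le_mul_of_nonneg_left (hb _ _) (norm_nonneg _)

/-- By Fubini the Gabor transform passes inside the superposition. The single majorant `h` controls
both the values and the transforms of the integrands. -/
theorem gaborDecay_superposition {U : 𝔼 ι × 𝔼 ι → ℂ} {k : 𝔼 ι × 𝔼 ι → 𝔼 ι → ℂ}
    {h : 𝔼 ι × 𝔼 ι → ℝ} (hU : AEStronglyMeasurable U)
    (hk : Continuous fun p : (𝔼 ι × 𝔼 ι) × 𝔼 ι => k p.1 p.2) (hh : Integrable h)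
    (hb : ∀ z t, ‖U z * k z t‖ ≤ h z)
    (hw : ∀ l, 0 < l → ∃ C, ∀ z w,
      ‖U z * gaborTransform (k z) w‖ ≤ C * h z * Real.exp (-(l * ω.wt₂ w))) :
    GaborDecay ω (fun t => ∫ z, U z * k z t) := by
  have hkt : ∀ t, Continuous fun z => k z t := fun t =>
    hk.comp (Continuous.prodMk continuous_id continuous_const)
  refine ⟨?_, ⟨∫ z, h z, fun t => ?_⟩, fun l hl => ?_⟩
  · refine continuous_of_dominated (bound := h)
      (fun t => hU.mul (hkt t).aestronglyMeasurable)
      (fun t => Eventually.of_forall fun z => hb z t) hh (Eventually.of_forall fun z => ?_)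
    exact continuous_const.mul (hk.comp (Continuous.prodMk continuous_const continuous_id))
  · exact norm_integral_le_of_norm_le hh (Eventually.of_forall fun z => hb z t)
  · obtain ⟨C, hC⟩ := hw l hl
    refine ⟨C * ∫ z, h z, fun w => ?_⟩
    rw [gaborTransform, integral_superposition_mul hU hk hh hb (integrable_gabor w),
      ← integral_const_mul, ← integral_mul_const]
    exact norm_integral_le_of_norm_le ((hh.const_mul C).mul_const _)
      (Eventually.of_forall fun z => hC z w)

/-- An atom and its Fourier transform decay about `z.1` and `z.2`. Recentring both at the origin at
rate `2 * l` costs the factor growing in `z`. -/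
theorem exists_gaborTransform_gabor_le (ω : OmegaWeight) (ι : Type*) [Fintype ι] {l : ℝ}
    (hl : 0 ≤ l) : ∃ C, 0 ≤ C ∧ ∀ z w : 𝔼 ι × 𝔼 ι,
      ‖gaborTransform (gabor z) w‖ ≤ C * Real.exp (2 * l * ω.wt₂ z) * Real.exp (-(l * ω.wt₂ w)) := by
  obtain ⟨C, hC, h⟩ := exists_norm_gaborTransform_le (ι := ι) ω hl
  obtain ⟨D, hD, hg⟩ := ω.exists_norm_gabor_le (E := 𝔼 ι) (2 * l)
  set G := ‖gaussianConst ι‖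
  have hshift : ∀ (z : 𝔼 ι × 𝔼 ι) t, ω.wt z.1 ≤ ω.wt₂ z → ‖gabor z t‖ ≤
      D * Real.exp (2 * l * ω.wt₂ z) * Real.exp (-(2 * l * ω.wt t)) := fun z t hz => by
    refine (hg z t).trans ?_
    rw [mul_assoc D, ← Real.exp_add]
    refine mul_le_mul_of_nonneg_left (Real.exp_le_exp.2 ?_) hD
    have := mul_le_mul_of_nonneg_left (ω.wt_le_add_sub t z.1) (by positivity : 0 ≤ 2 * l)
    have := mul_le_mul_of_nonneg_left hz (by positivity : 0 ≤ 2 * l)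
    linarith
  have hle : ∀ z : 𝔼 ι × 𝔼 ι, ω.wt z.1 ≤ ω.wt₂ z := fun z =>
    le_add_of_nonneg_right (ω.wt_nonneg z.2)
  refine ⟨C * (D + G * D), by positivity, fun z w => ?_⟩
  refine (h (gabor z) (D * Real.exp (2 * l * ω.wt₂ z)) (G * (D * Real.exp (2 * l * ω.wt₂ z)))
    (integrable_gabor z) (by positivity) (by positivity) (fun t => hshift z t (hle z))
    (fun t => ?_) w).trans_eq (by ring)
  rw [omegaFourier_gabor, norm_mul, norm_mul, norm_exp_I_inner, mul_one, mul_assoc]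
  refine mul_le_mul_of_nonneg_left ?_ (norm_nonneg _)
  have := hshift (z.2, -z.1) t (hle _)
  rwa [GaborDecay.wt₂_rotate] at this

theorem exists_seminorm_le_of_isVonNBounded {S : Set (OmegaSchwartz ω ι)}
    (hS : Bornology.IsVonNBounded ℂ S) {q : Seminorm ℂ (OmegaSchwartz ω ι)} (hq : Continuous q) :
    ∃ r, ∀ g ∈ S, q g ≤ r := by
  have hball : q.ball 0 1 ∈ nhds (0 : OmegaSchwartz ω ι) := by
    rw [Seminorm.ball_zero_eq]
    exact (isOpen_lt hq continuous_const).mem_nhds (by simp)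
  obtain ⟨r, hr, h⟩ := (hS hball).exists_pos
  refine ⟨r, fun g hg => ?_⟩
  have hn : ‖(r : ℂ)‖ = r := by rw [Complex.norm_real, Real.norm_of_nonneg hr.le]
  obtain ⟨y, hy, rfl⟩ := h (r : ℂ) hn.ge hg
  have hy' : q y < 1 := q.mem_ball_zero.1 hy
  change q ((r : ℂ) • y) ≤ r
  rw [map_smul_eq_mul, hn]
  exact mul_le_of_le_one_right hr.le hy'.le

/-- `𝓢_ω` is sequentially dense in `𝓢'_ω` for the strong topology. -/
theorem exists_tendsto_toDistribution (u : OmegaDistribution ω ι) :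
    ∃ f : ℕ → OmegaSchwartz ω ι, Tendsto (fun n => (f n).toDistribution) atTop (nhds u) := by
  obtain ⟨U, l, hU, hUi, hu⟩ := exists_representation u
  obtain ⟨q, hq, hqW⟩ := OmegaSchwartz.exists_seminorm_gaborTransform_le ω ι l
  -- Formally `u` is the superposition of atoms with density `U`. Cutting `U` off to a ball makes
  -- the superposition a genuine element of `𝓢_ω`.
  let V : ℕ → 𝔼 ι × 𝔼 ι → ℂ := fun n => (Metric.closedBall 0 n).indicator U
  have hVm : ∀ n, AEStronglyMeasurable (V n) := fun n =>
    hU.indicator Metric.isClosed_closedBall.measurableSet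
  have hw : ∀ (n : ℕ) (z : 𝔼 ι × 𝔼 ι), z ∈ Metric.closedBall 0 (n : ℝ) →
      ω.wt₂ z ≤ 2 * ω.toFun n := fun n z hz => by
    rw [mem_closedBall_zero_iff] at hz
    have h1 := ω.monotoneOn (norm_nonneg z.1) (mem_Ici.2 n.cast_nonneg)
      ((norm_fst_le z).trans hz)
    have h2 := ω.monotoneOn (norm_nonneg z.2) (mem_Ici.2 n.cast_nonneg)
      ((norm_snd_le z).trans hz)
    simp only [OmegaWeight.wt₂, OmegaWeight.wt]
    linarith
  have hVi : ∀ n, Integrable fun z => ‖V n z‖ := fun n => by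
    refine (hUi.const_mul (Real.exp (|l| * (2 * ω.toFun n)))).mono' (hVm n).norm
      (Eventually.of_forall fun z => ?_)
    rw [norm_norm]
    by_cases hz : z ∈ Metric.closedBall 0 (n : ℝ)
    · rw [show V n z = U z from indicator_of_mem hz U, mul_left_comm, ← Real.exp_add]
      refine le_mul_of_one_le_right (norm_nonneg _) (Real.one_le_exp ?_)
      have h1 := mul_le_mul_of_nonneg_left (hw n z hz) (abs_nonneg l)
      have h2 := mul_le_mul_of_nonneg_right (le_abs_self l) (ω.wt₂_nonneg z)
      linarith
    · rw [show V n z = 0 from indicator_of_notMem hz U, norm_zero]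
      positivity
  have hVb : ∀ (n : ℕ) z t, ‖V n z * gabor z t‖ ≤ ‖V n z‖ := fun n z t => by
    rw [norm_mul]
    exact mul_le_of_le_one_right (norm_nonneg _) (norm_gabor_le_one z t)
  have hdec : ∀ n, GaborDecay ω (fun t => ∫ z, V n z * gabor z t) := fun n => by
    refine gaborDecay_superposition (hVm n) continuous_gabor (hVi n) (hVb n) fun m hm => ?_
    obtain ⟨C, hC, h⟩ := exists_gaborTransform_gabor_le ω ι hm.le
    refine ⟨C * Real.exp (2 * m * (2 * ω.toFun n)), fun z w => ?_⟩
    by_cases hz : z ∈ Metric.closedBall 0 (n : ℝ)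
    · rw [norm_mul, mul_comm, mul_right_comm]
      refine mul_le_mul_of_nonneg_right ((h z w).trans ?_) (norm_nonneg _)
      gcongr
      exact hw n z hz
    · rw [show V n z = 0 from indicator_of_notMem hz U]
      simp
  choose f hf using fun n => (hdec n).exists_omegaSchwartz
  have hfg : ∀ n g, (f n).toDistribution g = ∫ z, V n z * gaborTransform g z := fun n g => by
    change ∫ x, f n x * g x = _
    rw [hf n, integral_superposition_mul (hVm n) continuous_gabor (hVi n) (hVb n) g.integrable]
    simp only [gaborTransform, mul_comm]
  have hVle : ∀ n z, ‖V n z‖ ≤ ‖U z‖ := fun n z => norm_indicator_le_norm_self _ _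
  have hUW : ∀ g : OmegaSchwartz ω ι, ∀ T : 𝔼 ι × 𝔼 ι → ℂ, AEStronglyMeasurable T →
      (∀ z, ‖T z‖ ≤ ‖U z‖) → Integrable fun z => T z * gaborTransform g z := fun g T hT hTU => by
    refine (hUi.const_mul (q g)).mono' (hT.mul
      (stronglyMeasurable_gaborTransform g.continuous).aestronglyMeasurable)
      (Eventually.of_forall fun z => ?_)
    rw [norm_mul]
    refine (mul_le_mul (hTU z) (hqW g z) (norm_nonneg _) (norm_nonneg _)).trans_eq ?_
    ring
  have hUV : ∀ n z, ‖V n z - U z‖ ≤ ‖U z‖ := fun n z => by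
    by_cases hz : z ∈ Metric.closedBall 0 (n : ℝ)
    · rw [show V n z = U z from indicator_of_mem hz U]
      simp
    · rw [show V n z = 0 from indicator_of_notMem hz U]
      simp
  set ε : ℕ → ℝ := fun n => ∫ z, ‖V n z - U z‖ * Real.exp (-(l * ω.wt₂ z)) with hε
  have hexp : Continuous fun z : 𝔼 ι × 𝔼 ι => Real.exp (-(l * ω.wt₂ z)) :=
    Real.continuous_exp.comp (ω.continuous_wt₂.const_mul l).neg
  have hεle : ∀ n z, ‖V n z - U z‖ * Real.exp (-(l * ω.wt₂ z)) ≤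
      ‖U z‖ * Real.exp (-(l * ω.wt₂ z)) := fun n z => by
    gcongr
    exact hUV n z
  have hεm : ∀ n, AEStronglyMeasurable fun z => ‖V n z - U z‖ * Real.exp (-(l * ω.wt₂ z)) :=
    fun n => ((hVm n).sub hU).norm.mul hexp.aestronglyMeasurable
  have hε0 : Tendsto ε atTop (nhds 0) := by
    rw [show (0 : ℝ) = ∫ _ : 𝔼 ι × 𝔼 ι, (0 : ℝ) by simp]
    refine tendsto_integral_of_dominated_convergence _ hεm hUi (fun n => Eventually.of_forall
      fun z => ?_) (Eventually.of_forall fun z => ?_)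
    · rw [Real.norm_of_nonneg (by positivity)]
      exact hεle n z
    · refine tendsto_const_nhds.congr' ?_
      obtain ⟨N, hN⟩ := exists_nat_ge ‖z‖
      filter_upwards [eventually_ge_atTop N] with n hn
      have hz : z ∈ Metric.closedBall 0 (n : ℝ) := by
        rw [mem_closedBall_zero_iff]
        exact hN.trans (by exact_mod_cast hn)
      rw [show V n z = U z from indicator_of_mem hz U]
      simp
  -- The test function enters only through a continuous seminorm, so convergence is uniform on
  -- bounded sets, as the strong topology demands.
  have hbound : ∀ n g, ‖((f n).toDistribution - u) g‖ ≤ q g * ε n := fun n g => by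
    change ‖(f n).toDistribution g - u g‖ ≤ _
    rw [hfg, hu, ← integral_sub (hUW g _ (hVm n) (hVle n)) (hUW g _ hU fun _ => le_rfl), hε,
      ← integral_const_mul]
    refine norm_integral_le_of_norm_le ((hUi.mono' (hεm n) (Eventually.of_forall fun z => ?_)).const_mul
      (q g)) (Eventually.of_forall fun z => ?_)
    · rw [Real.norm_of_nonneg (by positivity)]
      exact hεle n z
    · rw [← sub_mul, norm_mul]
      refine (mul_le_mul_of_nonneg_left (hqW g z) (norm_nonneg _)).trans_eq ?_
      ring
  refine ⟨f, ?_⟩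
  rw [← tendsto_sub_nhds_zero_iff]
  refine (ContinuousLinearMap.hasBasis_nhds_zero_of_basis Metric.nhds_basis_ball).tendsto_right_iff.2 ?_
  rintro ⟨S, δ⟩ ⟨hS, hδ⟩
  obtain ⟨r, hr⟩ := exists_seminorm_le_of_isVonNBounded hS hq
  have hlim : Tendsto (fun n => |r| * ε n) atTop (nhds 0) := by
    simpa using hε0.const_mul |r|
  filter_upwards [hlim.eventually (gt_mem_nhds hδ)] with n hn g hg
  rw [mem_ball_zero_iff]
  refine ((hbound n g).trans ?_).trans_lt hn
  have : 0 ≤ ε n := integral_nonneg fun z => by positivity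
  exact mul_le_mul_of_nonneg_right ((hr g hg).trans (le_abs_self r)) this

end Superposition

/-! ### Integral operators with rapidly decaying kernels. -/

section Kernel

variable {ι : Type*} [Fintype ι] {ω : OmegaWeight}

local notation "𝔼" => EuclideanSpace ℝ

/-- A continuous linear map into `𝓢_ω` from a linear map into functions whose Gabor transforms
are controlled by continuous seminorms. -/
theorem exists_clm_of_gaborTransform_le (Φ : OmegaSchwartz ω ι →ₗ[ℂ] 𝔼 ι → ℂ)
    (hΦ : ∀ f, GaborDecay ω (Φ f))
    (h : ∀ l, 0 < l → ∃ q : Seminorm ℂ (OmegaSchwartz ω ι), Continuous q ∧ ∀ f z,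
      ‖gaborTransform (Φ f) z‖ ≤ q f * Real.exp (-(l * ω.wt₂ z))) :
    ∃ L : OmegaSchwartz ω ι →L[ℂ] OmegaSchwartz ω ι, ∀ f, (L f : 𝔼 ι → ℂ) = Φ f := by
  choose L hL using fun f => (hΦ f).exists_omegaSchwartz
  let L' : OmegaSchwartz ω ι →ₗ[ℂ] OmegaSchwartz ω ι :=
    { toFun := L
      map_add' := fun f g => OmegaSchwartz.ext fun x => by
        change L (f + g) x = L f x + L g x
        rw [hL, hL, hL, map_add, Pi.add_apply]
      map_smul' := fun c f => OmegaSchwartz.ext fun x => by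
        change L (c • f) x = c • L f x
        rw [hL, hL, map_smul, Pi.smul_apply] }
  refine ⟨⟨L', OmegaSchwartz.continuous_of_gaborTransform_le L' fun l hl => ?_⟩, hL⟩
  obtain ⟨q, hq, hle⟩ := h l hl
  refine ⟨q, hq, fun f z => ?_⟩
  change ‖gaborTransform (L f) z‖ ≤ _
  rw [hL]
  exact hle f z

/-- The Fourier transform is continuous on `𝓢_ω`. -/
theorem exists_fourierCLM (ω : OmegaWeight) (ι : Type*) [Fintype ι] :
    ∃ L : OmegaSchwartz ω ι →L[ℂ] OmegaSchwartz ω ι, ∀ f, (L f : 𝔼 ι → ℂ) = omegaFourier f := by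
  let Φ : OmegaSchwartz ω ι →ₗ[ℂ] 𝔼 ι → ℂ :=
    { toFun := fun f => omegaFourier f
      map_add' := fun f g => funext fun x => DFunLike.congr_fun
        (map_add (schwartzFourier ι ∘ₗ OmegaSchwartz.toSchwartz ω ι) f g) x
      map_smul' := fun c f => funext fun x => DFunLike.congr_fun
        (map_smul (schwartzFourier ι ∘ₗ OmegaSchwartz.toSchwartz ω ι) c f) x }
  refine exists_clm_of_gaborTransform_le Φ (fun f => f.gaborDecay.omegaFourier) fun l _ => ?_
  obtain ⟨q, hq, hle⟩ := OmegaSchwartz.exists_seminorm_gaborTransform_le ω ι l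
  refine ⟨‖gaussianConst ι‖₊ • q, continuous_const.mul hq, fun f z => ?_⟩
  change ‖gaborTransform (omegaFourier f) z‖ ≤ ‖gaussianConst ι‖ * q f * _
  rw [GaborDecay.gaborTransform_omegaFourier f.integrable, mul_assoc, ← GaborDecay.wt₂_rotate]
  exact mul_le_mul_of_nonneg_left (hle f _) (norm_nonneg _)

/-- Kernels of `ω`-regularizing operators. -/
structure KernelDecay (ω : OmegaWeight) (k : 𝔼 ι → 𝔼 ι → ℂ) : Prop where
  continuous : Continuous fun p : 𝔼 ι × 𝔼 ι => k p.1 p.2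
  decay : ∀ l, 0 < l → ∃ C, 0 ≤ C ∧ ∀ x ξ, ‖k x ξ‖ ≤ C * Real.exp (-(l * ω.wt₂ (x, ξ)))
  right : ∀ l, 0 < l → ∃ C, 0 ≤ C ∧ ∀ x z,
    ‖gaborTransform (k x) z‖ ≤ C * Real.exp (-(l * (ω.wt x + ω.wt₂ z)))
  left : ∀ l, 0 < l → ∃ C, 0 ≤ C ∧ ∀ ξ z,
    ‖gaborTransform (fun x => k x ξ) z‖ ≤ C * Real.exp (-(l * (ω.wt ξ + ω.wt₂ z)))

namespace KernelDecay

variable {k : 𝔼 ι → 𝔼 ι → ℂ}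

theorem flip (hk : KernelDecay ω k) : KernelDecay ω (fun ξ x => k x ξ) where
  continuous := hk.continuous.comp continuous_swap
  decay l hl := by
    obtain ⟨C, hC, h⟩ := hk.decay l hl
    refine ⟨C, hC, fun ξ x => (h x ξ).trans_eq ?_⟩
    simp only [OmegaWeight.wt₂, add_comm]
  right := hk.left
  left := hk.right

theorem exists_norm_le (hk : KernelDecay ω k) :
    ∃ C, 0 ≤ C ∧ ∀ x ξ, ‖k x ξ‖ ≤ C * Real.exp (-(1 * ω.wt ξ)) ∧ ‖k x ξ‖ ≤ C := by
  obtain ⟨C, hC, h⟩ := hk.decay 1 one_pos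
  refine ⟨C, hC, fun x ξ => ?_⟩
  have h1 := ω.wt_nonneg x
  have h2 := ω.wt_nonneg ξ
  constructor
  · refine (h x ξ).trans (mul_le_mul_of_nonneg_left (Real.exp_le_exp.2 ?_) hC)
    simp only [OmegaWeight.wt₂]
    linarith
  · refine (h x ξ).trans (mul_le_of_le_one_right hC (Real.exp_le_one_iff.2 ?_))
    simp only [OmegaWeight.wt₂]
    linarith

theorem integral_mul_comm (hk : KernelDecay ω k) {f g : 𝔼 ι → ℂ} (hf : Integrable f)
    (hg : Integrable g) :
    ∫ x, (∫ ξ, k x ξ * f ξ) * g x = ∫ ξ, (∫ x, k x ξ * g x) * f ξ := by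
  obtain ⟨C, hC, h⟩ := hk.exists_norm_le
  simp only [← integral_mul_const]
  rw [integral_integral_swap]
  · congr 1; ext ξ; congr 1; ext x; ring
  · refine ((hg.mul_prod hf).bdd_mul (c := C) hk.continuous.aestronglyMeasurable
      (Eventually.of_forall fun p => (h p.1 p.2).2)).congr (Eventually.of_forall fun p => ?_)
    simp only [Function.uncurry]
    ring

theorem integrable_mul (hk : KernelDecay ω k) {f : 𝔼 ι → ℂ} (hf : Integrable f) (x : 𝔼 ι) :
    Integrable fun ξ => k x ξ * f ξ := by
  obtain ⟨C, -, h⟩ := hk.exists_norm_le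
  exact hf.bdd_mul (c := C) (hk.continuous.comp (by fun_prop : Continuous fun ξ => (x, ξ))).aestronglyMeasurable
    (Eventually.of_forall fun ξ => (h x ξ).2)

/-- The transform in `x` falls on the kernel alone, so a sup bound on `f` suffices. -/
theorem exists_gaborTransform_integral_le (hk : KernelDecay ω k) {l : ℝ} (hl : 0 < l) :
    ∃ C, 0 ≤ C ∧ ∀ (f : 𝔼 ι → ℂ) (M : ℝ), Integrable f → (∀ x, ‖f x‖ ≤ M) →
      ∀ z, ‖gaborTransform (fun x => ∫ ξ, k x ξ * f ξ) z‖ ≤ C * M * Real.exp (-(l * ω.wt₂ z)) := by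
  obtain ⟨C, hC, h⟩ := hk.left l hl
  have hI := ω.integrable_exp_neg_wt (volume : Measure (𝔼 ι)) hl
  refine ⟨C * ∫ ξ : 𝔼 ι, Real.exp (-(l * ω.wt ξ)), mul_nonneg hC
    (integral_nonneg fun _ => (Real.exp_pos _).le), fun f M hf hM z => ?_⟩
  rw [gaborTransform, hk.integral_mul_comm hf (integrable_gabor z)]
  refine (norm_integral_le_of_norm_le (hI.const_mul (C * M * Real.exp (-(l * ω.wt₂ z))))
    (Eventually.of_forall fun ξ => ?_)).trans_eq ?_
  · rw [norm_mul]
    refine (mul_le_mul (h ξ z) (hM ξ) (norm_nonneg _) (by positivity)).trans_eq ?_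
    rw [mul_add, neg_add, Real.exp_add]
    ring
  · rw [integral_const_mul]
    ring

theorem continuous_integral (hk : KernelDecay ω k) {f : 𝔼 ι → ℂ} (hf : Integrable f) :
    Continuous fun x => ∫ ξ, k x ξ * f ξ := by
  obtain ⟨C, hC, h⟩ := hk.exists_norm_le
  refine continuous_of_dominated (bound := fun ξ => C * ‖f ξ‖)
    (fun x => (hk.integrable_mul hf x).aestronglyMeasurable)
    (fun x => Eventually.of_forall fun ξ => ?_) (hf.norm.const_mul C)
    (Eventually.of_forall fun ξ => ?_)
  · rw [norm_mul]
    exact mul_le_mul_of_nonneg_right (h x ξ).2 (norm_nonneg _)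
  · exact (hk.continuous.comp (by fun_prop : Continuous fun x => (x, ξ))).mul continuous_const

theorem gaborDecay_integral (hk : KernelDecay ω k) {f : 𝔼 ι → ℂ} {M : ℝ} (hf : Integrable f)
    (hM : ∀ x, ‖f x‖ ≤ M) : GaborDecay ω fun x => ∫ ξ, k x ξ * f ξ := by
  refine ⟨hk.continuous_integral hf, ?_, fun l hl => ?_⟩
  · obtain ⟨C, hC, h⟩ := hk.exists_norm_le
    refine ⟨∫ ξ, C * ‖f ξ‖, fun x => norm_integral_le_of_norm_le (hf.norm.const_mul C)
      (Eventually.of_forall fun ξ => ?_)⟩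
    rw [norm_mul]
    exact mul_le_mul_of_nonneg_right (h x ξ).2 (norm_nonneg _)
  · obtain ⟨C, -, h⟩ := hk.exists_gaborTransform_integral_le hl
    exact ⟨C * M, h f M hf hM⟩

/-- The integral operator with kernel `k` is continuous on `𝓢_ω`. -/
theorem exists_clm (hk : KernelDecay ω k) :
    ∃ L : OmegaSchwartz ω ι →L[ℂ] OmegaSchwartz ω ι,
      ∀ f, (L f : 𝔼 ι → ℂ) = fun x => ∫ ξ, k x ξ * f ξ := by
  let Φ : OmegaSchwartz ω ι →ₗ[ℂ] 𝔼 ι → ℂ :=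
    { toFun := fun f x => ∫ ξ, k x ξ * f ξ
      map_add' := fun f g => funext fun x => by
        rw [Pi.add_apply, ← integral_add (hk.integrable_mul f.integrable x)
          (hk.integrable_mul g.integrable x)]
        congr 1; ext ξ
        rw [map_add, add_apply, mul_add]
      map_smul' := fun c f => funext fun x => by
        rw [RingHom.id_apply, Pi.smul_apply, smul_eq_mul, ← integral_const_mul]
        congr 1; ext ξ
        rw [map_smul, smul_apply, smul_eq_mul, mul_left_comm] }
  refine exists_clm_of_gaborTransform_le Φ
    (fun f => hk.gaborDecay_integral f.integrable f.norm_apply_le) fun l hl => ?_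
  obtain ⟨C, hC, h⟩ := hk.exists_gaborTransform_integral_le hl
  let c : NNReal := ⟨C, hC⟩
  refine ⟨c • OmegaSchwartz.seminormFamily ω ι (Sum.inl (⟨1, mem_Ioi.2 one_pos⟩, 0)),
    continuous_const.mul ((OmegaSchwartz.withSeminorms ω ι).continuous_seminorm _),
    fun f z => h f _ f.integrable f.norm_apply_le z⟩

/-- Transforming in `ξ` first gives decay in `z`, and transforming in `x` first gives decay in `w`.
Fubini identifies the two double transforms, and the geometric mean joins the bounds. -/
theorem exists_gaborMatrix_le (hk : KernelDecay ω k) {m : ℝ} (hm : 0 < m) :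
    ∃ C, 0 ≤ C ∧ ∀ z w, ‖gaborTransform (fun x => gaborTransform (k x) z) w‖ ≤
      C * Real.exp (-(m * ω.wt₂ z)) * Real.exp (-(m * ω.wt₂ w)) := by
  have key : ∀ {k : 𝔼 ι → 𝔼 ι → ℂ}, KernelDecay ω k → ∃ C, 0 ≤ C ∧ ∀ z w,
      ‖gaborTransform (fun x => gaborTransform (k x) z) w‖ ≤
        C * Real.exp (-(2 * m * ω.wt₂ z)) := fun {k} hk => by
    obtain ⟨A, hA, hA'⟩ := exists_norm_gaborTransform_le_of_decay (ι := ι) ω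
      (by positivity : 0 ≤ 2 * m)
    obtain ⟨C, hC, h⟩ := hk.right (2 * m) (by positivity)
    refine ⟨A * C, by positivity, fun z w => ?_⟩
    refine (hA' _ (C * Real.exp (-(2 * m * ω.wt₂ z))) (by positivity) (fun x => ?_) w).trans ?_
    · refine (h x z).trans_eq ?_
      rw [mul_assoc C, ← Real.exp_add]
      congr 2
      ring
    · rw [← mul_assoc]
      refine mul_le_of_le_one_right (by positivity) (Real.exp_le_one_iff.2 ?_)
      exact neg_nonpos.2 (mul_nonneg (by positivity) (ω.wt_nonneg _))
  obtain ⟨C₁, h₁, hC₁⟩ := key hk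
  obtain ⟨C₂, h₂, hC₂⟩ := key hk.flip
  refine ⟨C₁ + C₂, by positivity, fun z w => ?_⟩
  have hswap : gaborTransform (fun x => gaborTransform (k x) z) w =
      gaborTransform (fun ξ => gaborTransform (fun x => k x ξ) w) z :=
    hk.integral_mul_comm (integrable_gabor z) (integrable_gabor w)
  refine (le_exp_of_le_of_le h₁ h₂ (hC₁ z w) (by rw [hswap]; exact hC₂ w z)).trans_eq ?_
  rw [mul_assoc (C₁ + C₂), ← Real.exp_add]
  congr 2
  ring

/-- The transposed integral operator maps `𝓢'_ω` into `𝓢_ω`. -/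
theorem exists_comp_eq_toDistribution (hk : KernelDecay ω k) (u : OmegaDistribution ω ι)
    (L : OmegaSchwartz ω ι →L[ℂ] OmegaSchwartz ω ι)
    (hL : ∀ g, (L g : 𝔼 ι → ℂ) = fun ξ => ∫ x, k x ξ * g x) :
    ∃ f : OmegaSchwartz ω ι, u.comp L = f.toDistribution := by
  obtain ⟨U, l, hU, hUi, hu⟩ := exists_representation u
  obtain ⟨C, hC, hr⟩ := hk.right (|l| + 1) (by positivity)
  have hκc : Continuous fun p : (𝔼 ι × 𝔼 ι) × 𝔼 ι => gaborTransform (k p.2) p.1 := by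
    obtain ⟨A, hA, h⟩ := hk.exists_norm_le
    refine continuous_of_dominated (bound := fun ξ => A * Real.exp (-(1 * ω.wt ξ)))
      (fun p => (hk.integrable_mul (integrable_gabor p.1) p.2).aestronglyMeasurable)
      (fun p => Eventually.of_forall fun ξ => ?_)
      ((ω.integrable_exp_neg_wt _ one_pos).const_mul A) (Eventually.of_forall fun ξ => ?_)
    · rw [norm_mul]
      exact (mul_le_of_le_one_right (norm_nonneg _) (norm_gabor_le_one _ _)).trans (h _ _).1
    · exact (hk.continuous.comp
        (by fun_prop : Continuous fun p : (𝔼 ι × 𝔼 ι) × 𝔼 ι => (p.2, ξ))).mul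
        (continuous_gabor.comp (by fun_prop : Continuous fun p : (𝔼 ι × 𝔼 ι) × 𝔼 ι => (p.1, ξ)))
  have hle : ∀ m, l ≤ m → ∀ z : 𝔼 ι × 𝔼 ι,
      Real.exp (-(m * ω.wt₂ z)) ≤ Real.exp (-(l * ω.wt₂ z)) := fun m hm z =>
    Real.exp_le_exp.2 (neg_le_neg (mul_le_mul_of_nonneg_right hm (ω.wt₂_nonneg z)))
  have hl' : l ≤ |l| + 1 := (le_abs_self l).trans (by linarith)
  -- The majorant for the function `x ↦ u(k(x,·))`. The constant `C + 1` is at least `C`, for the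
  -- pointwise bound, and at least `1`, for the bound on transforms.
  have hh : Integrable fun z => (C + 1) * (‖U z‖ * Real.exp (-(l * ω.wt₂ z))) := hUi.const_mul _
  have hb : ∀ z x, ‖U z * gaborTransform (k x) z‖ ≤
      (C + 1) * (‖U z‖ * Real.exp (-(l * ω.wt₂ z))) := fun z x => by
    have h1 : Real.exp (-((|l| + 1) * (ω.wt x + ω.wt₂ z))) ≤ Real.exp (-(l * ω.wt₂ z)) := by
      refine le_trans (Real.exp_le_exp.2 ?_) (hle _ hl' z)
      nlinarith [abs_nonneg l, ω.wt_nonneg x]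
    rw [norm_mul, mul_left_comm]
    refine mul_le_mul_of_nonneg_left ((hr x z).trans ?_) (norm_nonneg _)
    exact mul_le_mul (by linarith) h1 (Real.exp_pos _).le (by positivity)
  have hdec : GaborDecay ω fun x => ∫ z, U z * gaborTransform (k x) z := by
    refine gaborDecay_superposition hU hκc hh hb fun m hm => ?_
    -- One rate dominating both `l`, to offset the growth of `U` in `z`, and `m`, the decay wanted
    -- in `w`.
    obtain ⟨D, hD, h⟩ := hk.exists_gaborMatrix_le (m := |l| + 1 + m) (by positivity)
    refine ⟨D, fun z w => ?_⟩
    have h1 : Real.exp (-((|l| + 1 + m) * ω.wt₂ w)) ≤ Real.exp (-(m * ω.wt₂ w)) :=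
      Real.exp_le_exp.2 (neg_le_neg (mul_le_mul_of_nonneg_right
        (by linarith [abs_nonneg l]) (ω.wt₂_nonneg w)))
    have h2 := hle (|l| + 1 + m) (by linarith) z
    calc ‖U z * gaborTransform (fun x => gaborTransform (k x) z) w‖
        ≤ ‖U z‖ * (D * Real.exp (-(l * ω.wt₂ z)) * Real.exp (-(m * ω.wt₂ w))) := by
          rw [norm_mul]
          refine mul_le_mul_of_nonneg_left ((h z w).trans ?_) (norm_nonneg _)
          gcongr
      _ = 1 * (D * (‖U z‖ * Real.exp (-(l * ω.wt₂ z))) * Real.exp (-(m * ω.wt₂ w))) := by ring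
      _ ≤ (C + 1) * (D * (‖U z‖ * Real.exp (-(l * ω.wt₂ z))) * Real.exp (-(m * ω.wt₂ w))) := by
          gcongr
          linarith
      _ = _ := by ring
  obtain ⟨f, hf⟩ := hdec.exists_omegaSchwartz
  refine ⟨f, ContinuousLinearMap.ext fun g => ?_⟩
  change u (L g) = ∫ x, f x * g x
  rw [hu, hf, integral_superposition_mul hU hκc hh hb g.integrable, hL]
  congr 1
  ext z
  congr 1
  exact hk.flip.integral_mul_comm g.integrable (integrable_gabor z)

end KernelDecay

end Kernel

/-! ### The kernel of a symbol in `𝓢_ω`. -/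

section Symbol

variable {ι : Type*} [Fintype ι] {ω : OmegaWeight}

local notation "𝔼" => EuclideanSpace ℝ

/-- The decay of a symbol `a` in `𝓢_ω`, expressed through `a` and a density `b` such that
`a(x,ξ) = ∫ b(y,η) e^{i⟨x,y⟩ + i⟨ξ,η⟩} dy dη`. -/
structure SymbolDecay (ω : OmegaWeight) (a : 𝔼 ι → 𝔼 ι → ℂ) (b : 𝔼 ι × 𝔼 ι → ℂ) : Prop where
  continuous : Continuous fun p : 𝔼 ι × 𝔼 ι => a p.1 p.2
  decay : ∀ l, 0 < l → ∃ C, 0 ≤ C ∧ ∀ x ξ, ‖a x ξ‖ ≤ C * Real.exp (-(l * ω.wt₂ (x, ξ)))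
  continuous_density : Continuous b
  density_decay : ∀ l, 0 < l → ∃ C, 0 ≤ C ∧ ∀ p, ‖b p‖ ≤ C * Real.exp (-(l * ω.wt₂ p))
  eq_integral : ∀ x ξ, a x ξ = ∫ p : 𝔼 ι × 𝔼 ι, b p *
    (Complex.exp (Complex.I * (⟪x, p.1⟫_ℝ : ℂ)) * Complex.exp (Complex.I * (⟪ξ, p.2⟫_ℝ : ℂ)))

/-- The kernel `e^{i⟨x,ξ⟩} a(x,ξ)`. -/
noncomputable def symbolKernel (a : 𝔼 ι → 𝔼 ι → ℂ) (x ξ : 𝔼 ι) : ℂ :=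
  Complex.exp (Complex.I * (⟪x, ξ⟫_ℝ : ℂ)) * a x ξ

theorem norm_symbolKernel (a : 𝔼 ι → 𝔼 ι → ℂ) (x ξ : 𝔼 ι) : ‖symbolKernel a x ξ‖ = ‖a x ξ‖ := by
  rw [symbolKernel, norm_mul, norm_exp_I_inner, one_mul]

namespace SymbolDecay

variable {a : 𝔼 ι → 𝔼 ι → ℂ} {b : 𝔼 ι × 𝔼 ι → ℂ}

theorem flip (h : SymbolDecay ω a b) : SymbolDecay ω (fun ξ x => a x ξ) (fun p => b p.swap) where
  continuous := h.continuous.comp continuous_swap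
  decay l hl := by
    obtain ⟨C, hC, h⟩ := h.decay l hl
    refine ⟨C, hC, fun ξ x => (h x ξ).trans_eq ?_⟩
    simp only [OmegaWeight.wt₂, add_comm]
  continuous_density := h.continuous_density.comp continuous_swap
  density_decay l hl := by
    obtain ⟨C, hC, h⟩ := h.density_decay l hl
    refine ⟨C, hC, fun p => (h p.swap).trans_eq ?_⟩
    simp only [OmegaWeight.wt₂, Prod.fst_swap, Prod.snd_swap, add_comm]
  eq_integral ξ x := by
    rw [h.eq_integral, Measure.volume_eq_prod, ← integral_prod_swap]
    congr 1
    ext p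
    rw [Prod.fst_swap, Prod.snd_swap, mul_comm (Complex.exp _)]

theorem continuous_symbolKernel (h : SymbolDecay ω a b) :
    Continuous fun p : 𝔼 ι × 𝔼 ι => symbolKernel a p.1 p.2 := by
  have := h.continuous
  unfold symbolKernel
  fun_prop

/-- With the symbol expanded in exponentials, the remaining `ξ`-integral is the Fourier transform of
an atom at a frequency shifted by `x`. -/
theorem gaborTransform_symbolKernel (h : SymbolDecay ω a b) (x : 𝔼 ι) (z : 𝔼 ι × 𝔼 ι) :
    gaborTransform (symbolKernel a x) z = ∫ p : 𝔼 ι × 𝔼 ι,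
      b p * Complex.exp (Complex.I * (⟪x, p.1⟫_ℝ : ℂ)) *
        omegaFourier (gabor z) (-(p.2 + x)) := by
  have hb : Integrable b := by
    obtain ⟨C, -, hC⟩ := h.density_decay 1 one_pos
    exact ((ω.integrable_exp_neg_wt₂ _ one_pos).const_mul C).mono'
      h.continuous_density.aestronglyMeasurable (Eventually.of_forall hC)
  simp only [gaborTransform, symbolKernel, h.eq_integral, omegaFourier, ← integral_const_mul,
    ← integral_mul_const]
  rw [integral_integral_swap]
  · congr 1; ext p; congr 1; ext ξ
    rw [inner_neg_right, inner_add_right, real_inner_comm x ξ]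
    push_cast
    rw [mul_neg, neg_neg, mul_add, Complex.exp_add]
    ring
  · have hc : Continuous fun q : 𝔼 ι × (𝔼 ι × 𝔼 ι) => Complex.exp (Complex.I * (⟪x, q.1⟫_ℝ : ℂ)) *
        (Complex.exp (Complex.I * (⟪x, q.2.1⟫_ℝ : ℂ)) *
          Complex.exp (Complex.I * (⟪q.1, q.2.2⟫_ℝ : ℂ))) := by fun_prop
    refine (((integrable_gabor z).mul_prod hb).bdd_mul (c := 1) hc.aestronglyMeasurable
      (Eventually.of_forall fun q => ?_)).congr (Eventually.of_forall fun q => ?_)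
    · simp only [norm_mul, norm_exp_I_inner, mul_one, le_refl]
    · simp only [Function.uncurry]
      ring

/-- Decay of the symbol controls `x` and `z.1`. Decay of its Fourier density controls `z.2`, but the
oscillation `e^{i⟨x,ξ⟩}` shifts frequencies by `x` and costs `e^{2lω(x)}`. Taking the first bound at
rate `4 * l` makes the geometric mean decay in all variables: `(-4l + 2l)/2 = -l` in `x`. -/
theorem exists_gaborTransform_symbolKernel_le (h : SymbolDecay ω a b) {l : ℝ} (hl : 0 < l) :
    ∃ C, 0 ≤ C ∧ ∀ x z, ‖gaborTransform (symbolKernel a x) z‖ ≤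
      C * Real.exp (-(l * (ω.wt x + ω.wt₂ z))) := by
  obtain ⟨A, hA, hA'⟩ := exists_norm_gaborTransform_le_of_decay (ι := ι) ω
    (by positivity : 0 ≤ 4 * l)
  obtain ⟨C, hC, hC'⟩ := h.decay (4 * l) (by positivity)
  have h1 : ∀ x z, ‖gaborTransform (symbolKernel a x) z‖ ≤
      A * C * Real.exp (-(4 * l * ω.wt x) + -(4 * l * ω.wt z.1)) := fun x z => by
    refine (hA' _ (C * Real.exp (-(4 * l * ω.wt x))) (by positivity) (fun ξ => ?_) z).trans_eq ?_
    · rw [norm_symbolKernel]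
      refine (hC' x ξ).trans_eq ?_
      rw [mul_assoc C, ← Real.exp_add]
      congr 2
      simp only [OmegaWeight.wt₂]
      ring
    · rw [Real.exp_add]
      ring
  obtain ⟨B, hB, hB'⟩ := h.density_decay (2 * l + 1) (by positivity)
  obtain ⟨D, hD, hD'⟩ := ω.exists_norm_gabor_le (E := 𝔼 ι) (2 * l)
  set G := ‖gaussianConst ι‖
  set I := ∫ p : 𝔼 ι × 𝔼 ι, Real.exp (-(1 * ω.wt₂ p))
  have hI : 0 ≤ I := integral_nonneg fun _ => (Real.exp_pos _).le
  have h2 : ∀ x z, ‖gaborTransform (symbolKernel a x) z‖ ≤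
      B * G * D * I * Real.exp (2 * l * ω.wt x + -(2 * l * ω.wt z.2)) := fun x z => by
    rw [h.gaborTransform_symbolKernel]
    refine (norm_integral_le_of_norm_le ((ω.integrable_exp_neg_wt₂ (volume : Measure (𝔼 ι))
      one_pos).const_mul (B * G * D * Real.exp (2 * l * ω.wt x + -(2 * l * ω.wt z.2))))
      (Eventually.of_forall fun p => ?_)).trans_eq ?_
    · rw [norm_mul, norm_mul, norm_exp_I_inner, mul_one, omegaFourier_gabor, norm_mul, norm_mul,
        norm_exp_I_inner, mul_one]
      have hw : ω.wt z.2 ≤ ω.wt x + ω.wt p.2 + ω.wt (-(p.2 + x) - z.2) := by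
        have e1 := ω.wt_le_add_sub z.2 (-(p.2 + x))
        have e2 := ω.wt_add_le p.2 x
        rw [ω.wt_neg, ω.wt_sub_comm] at e1
        linarith
      have hw' := mul_le_mul_of_nonneg_left hw (by positivity : 0 ≤ 2 * l)
      have hp : 0 ≤ 2 * l * ω.wt p.1 := mul_nonneg (by positivity) (ω.wt_nonneg _)
      calc ‖b p‖ * (G * ‖gabor (z.2, -z.1) (-(p.2 + x))‖)
          ≤ B * Real.exp (-((2 * l + 1) * ω.wt₂ p)) *
              (G * (D * Real.exp (-(2 * l * ω.wt (-(p.2 + x) - z.2))))) := by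
            gcongr
            · exact hB' p
            · exact hD' (z.2, -z.1) _
        _ = B * G * D * Real.exp (-((2 * l + 1) * ω.wt₂ p) +
              -(2 * l * ω.wt (-(p.2 + x) - z.2))) := by rw [Real.exp_add]; ring
        _ ≤ B * G * D * Real.exp (2 * l * ω.wt x + -(2 * l * ω.wt z.2) + -(1 * ω.wt₂ p)) := by
            refine mul_le_mul_of_nonneg_left (Real.exp_le_exp.2 ?_) (by positivity)
            simp only [OmegaWeight.wt₂]
            linarith
        _ = _ := by rw [Real.exp_add _ (-(1 * ω.wt₂ p))]; ring
    · rw [integral_const_mul]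
      change _ * I = _
      ring
  refine ⟨A * C + B * G * D * I, by positivity, fun x z => ?_⟩
  refine (le_exp_of_le_of_le (by positivity) (by positivity) (h1 x z) (h2 x z)).trans ?_
  refine mul_le_mul_of_nonneg_left (Real.exp_le_exp.2 ?_) (by positivity)
  have hz : 0 ≤ l * ω.wt z.1 := mul_nonneg hl.le (ω.wt_nonneg _)
  simp only [OmegaWeight.wt₂]
  linarith

theorem kernelDecay (h : SymbolDecay ω a b) : KernelDecay ω (symbolKernel a) where
  continuous := h.continuous_symbolKernel
  decay l hl := by
    obtain ⟨C, hC, hC'⟩ := h.decay l hl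
    exact ⟨C, hC, fun x ξ => (norm_symbolKernel a x ξ).trans_le (hC' x ξ)⟩
  right _ hl := h.exists_gaborTransform_symbolKernel_le hl
  left l hl := by
    obtain ⟨C, hC, hC'⟩ := h.flip.exists_gaborTransform_symbolKernel_le hl
    refine ⟨C, hC, fun ξ z => ?_⟩
    -- The phase is symmetric in `x` and `ξ`, so the transposed kernel is the kernel of the
    -- transposed symbol.
    have : (fun x => symbolKernel a x ξ) = symbolKernel (fun ξ x => a x ξ) ξ := by
      ext x
      rw [symbolKernel, symbolKernel, real_inner_comm]
    rw [this]
    exact hC' ξ z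

end SymbolDecay

/-- The identification of `ℝ^ι × ℝ^ι` with `ℝ^{ι ⊕ ι}`. -/
def euclideanJoin (p : 𝔼 ι × 𝔼 ι) : 𝔼 (ι ⊕ ι) := WithLp.toLp 2 (Sum.elim p.1 p.2)

theorem inner_euclideanJoin (p q : 𝔼 ι × 𝔼 ι) :
    ⟪euclideanJoin p, euclideanJoin q⟫_ℝ = ⟪p.1, q.1⟫_ℝ + ⟪p.2, q.2⟫_ℝ := by
  simp [euclideanJoin, PiLp.inner_apply, Fintype.sum_sum_type]

theorem norm_le_norm_euclideanJoin (p : 𝔼 ι × 𝔼 ι) :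
    ‖p.1‖ ≤ ‖euclideanJoin p‖ ∧ ‖p.2‖ ≤ ‖euclideanJoin p‖ := by
  have h := inner_euclideanJoin p p
  simp only [real_inner_self_eq_norm_sq] at h
  constructor <;> refine abs_le_of_sq_le_sq' ?_ (norm_nonneg _) |>.2 <;> nlinarith

omit [Fintype ι] in
theorem continuous_euclideanJoin : Continuous (euclideanJoin : 𝔼 ι × 𝔼 ι → 𝔼 (ι ⊕ ι)) := by
  refine (PiLp.continuous_toLp 2 _).comp (continuous_pi fun i => ?_)
  rcases i with i | i
  · exact (EuclideanSpace.proj (𝕜 := ℝ) i).continuous.comp continuous_fst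
  · exact (EuclideanSpace.proj (𝕜 := ℝ) i).continuous.comp continuous_snd

theorem integral_euclideanJoin (F : 𝔼 (ι ⊕ ι) → ℂ) :
    ∫ p : 𝔼 ι × 𝔼 ι, F (euclideanJoin p) = ∫ x, F x := by
  let e : 𝔼 ι × 𝔼 ι ≃ᵐ 𝔼 (ι ⊕ ι) :=
    ((MeasurableEquiv.toLp 2 (ι → ℝ)).symm.prodCongr (MeasurableEquiv.toLp 2 (ι → ℝ)).symm).trans
      ((MeasurableEquiv.sumPiEquivProdPi (fun _ : ι ⊕ ι => ℝ)).symm.trans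
        (MeasurableEquiv.toLp 2 (ι ⊕ ι → ℝ)))
  have he : MeasurePreserving e :=
    (((EuclideanSpace.volume_preserving_symm_measurableEquiv_toLp ι).prod
      (EuclideanSpace.volume_preserving_symm_measurableEquiv_toLp ι)).trans
      (volume_measurePreserving_sumPiEquivProdPi_symm (fun _ : ι ⊕ ι => ℝ))).trans
      (EuclideanSpace.volume_preserving_symm_measurableEquiv_toLp (ι ⊕ ι)).symm
  have hej : ∀ p, e p = euclideanJoin p := fun p => by
    ext i
    rcases i with i | i <;> rfl
  rw [← he.integral_comp']
  simp only [hej]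

theorem wt₂_le_wt_euclideanJoin (p : 𝔼 ι × 𝔼 ι) : ω.wt₂ p ≤ 2 * ω.wt (euclideanJoin p) := by
  have h1 := ω.wt_le_of_norm_le (norm_le_norm_euclideanJoin p).1
  have h2 := ω.wt_le_of_norm_le (norm_le_norm_euclideanJoin p).2
  simp only [OmegaWeight.wt₂]
  linarith

theorem OmegaSchwartz.exists_symbolDecay (a : OmegaSchwartz ω (ι ⊕ ι)) :
    ∃ b, SymbolDecay ω (fun x ξ => a (euclideanJoin (x, ξ))) b := by
  set c : ℂ := (((2 * Real.pi) ^ Fintype.card (ι ⊕ ι) : ℝ) : ℂ)⁻¹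
  have hdec : ∀ {f : 𝔼 (ι ⊕ ι) → ℂ} {N l : ℝ}, 0 < l → 0 ≤ N →
      (∀ x, ‖f x‖ ≤ N * Real.exp (-(2 * l * ω.wt x))) → ∀ p : 𝔼 ι × 𝔼 ι,
      ‖f (euclideanJoin p)‖ ≤ N * Real.exp (-(l * ω.wt₂ p)) := fun {f N l} hl hN h p => by
    refine (h _).trans (mul_le_mul_of_nonneg_left (Real.exp_le_exp.2 ?_) hN)
    have := mul_le_mul_of_nonneg_left (wt₂_le_wt_euclideanJoin (ω := ω) p) hl.le
    linarith
  refine ⟨fun p => c * omegaFourier a (euclideanJoin p), a.continuous.comp continuous_euclideanJoin,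
    fun l hl => ?_, ?_, fun l hl => ?_, fun x ξ => ?_⟩
  · exact ⟨_, apply_nonneg _ a, fun x ξ => hdec hl (apply_nonneg _ a)
      (a.norm_le_seminorm (by positivity : 0 < 2 * l)) (x, ξ)⟩
  · exact continuous_const.mul
      ((schwartzFourier (ι ⊕ ι) (toSchwartz ω _ a)).continuous.comp continuous_euclideanJoin)
  · refine ⟨‖c‖ * seminormFamily ω (ι ⊕ ι) (Sum.inr (⟨2 * l, by simpa using hl⟩, 0)) a,
      mul_nonneg (norm_nonneg _) (apply_nonneg _ a), fun p => ?_⟩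
    rw [norm_mul, mul_assoc]
    exact mul_le_mul_of_nonneg_left (hdec hl (apply_nonneg _ a)
      (a.norm_omegaFourier_le_seminorm (by positivity : 0 < 2 * l)) p) (norm_nonneg _)
  · rw [omegaFourier_inversion a.continuous a.integrable
      (schwartzFourier (ι ⊕ ι) (toSchwartz ω _ a)).integrable, ← integral_euclideanJoin,
      ← integral_const_mul]
    congr 1
    ext p
    rw [inner_euclideanJoin, Complex.ofReal_add, mul_add, Complex.exp_add]
    ring

end Symbol

/-! ### The extension, its uniqueness and the regularizing property. -/

theorem mainTheorem9 (ω : OmegaWeight) (d : ℕ) (a : OmegaSchwartz ω (Fin d ⊕ Fin d))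
    (ha : HasCompactSupport a) :
    ∃ T : OmegaDistribution ω (Fin d) →L[ℂ] OmegaDistribution ω (Fin d),
      IsKohnNirenbergExtension a T ∧
      (∀ T' : OmegaDistribution ω (Fin d) →L[ℂ] OmegaDistribution ω (Fin d),
        IsKohnNirenbergExtension a T' → T' = T) ∧
      ∀ u : OmegaDistribution ω (Fin d), ∃ g : OmegaSchwartz ω (Fin d),
        T u = g.toDistribution := by
  obtain ⟨b, hb⟩ := a.exists_symbolDecay
  set k := symbolKernel fun x ξ => a (euclideanJoin (x, ξ)) with hkdef
  have hk : KernelDecay ω k := hb.kernelDecay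
  obtain ⟨F, hF⟩ := exists_fourierCLM ω (Fin d)
  obtain ⟨M, hM⟩ := hk.exists_clm
  obtain ⟨N, hN⟩ := hk.flip.exists_clm
  set c : ℂ := ((2 * Real.pi : ℂ) ^ d)⁻¹
  -- The transpose of `c M F` for the bilinear pairing: `F` is its own transpose and `N` is the
  -- transpose of `M`.
  let S : OmegaSchwartz ω (Fin d) →L[ℂ] OmegaSchwartz ω (Fin d) := c • F.comp N
  have hMF : ∀ f x, (c • M (F f) : OmegaSchwartz ω (Fin d)) x = kohnNirenberg a f x := fun f x => by
    change c * M (F f) x = _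
    rw [hM, hF]
    rfl
  have hT : ∀ f : OmegaSchwartz ω (Fin d),
      f.toDistribution.comp S = (c • M (F f) : OmegaSchwartz ω (Fin d)).toDistribution := fun f => by
    refine ContinuousLinearMap.ext fun g => ?_
    change ∫ x, f x * (c * F (N g) x) = ∫ x, (c * M (F f) x) * g x
    simp only [mul_left_comm _ c, mul_assoc c]
    rw [integral_const_mul, integral_const_mul, hF, ← integral_omegaFourier_mul f.integrable
      (N g).integrable, hN, hM]
    congr 1
    rw [hk.integral_mul_comm (F f).integrable g.integrable, hF]
    simp only [mul_comm]
  have hext : IsKohnNirenbergExtension a (S.precomp ℂ : OmegaDistribution ω (Fin d) →L[ℂ] _) :=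
    fun f => ⟨c • M (F f), hMF f, hT f⟩
  -- Precomposition with a continuous map preserves bounded sets of test functions, hence is
  -- continuous for the strong topologies.
  refine ⟨S.precomp ℂ, hext, fun T' hT' => ?_, fun u => ?_⟩
  · have heq : ∀ f : OmegaSchwartz ω (Fin d),
        T' f.toDistribution = S.precomp ℂ f.toDistribution := fun f => by
      obtain ⟨g, hg, hTg⟩ := hT' f
      obtain ⟨g', hg', hTg'⟩ := hext f
      rw [hTg, hTg', OmegaSchwartz.ext fun x => (hg x).trans (hg' x).symm]
    refine ContinuousLinearMap.ext fun u => ?_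
    obtain ⟨f, hf⟩ := exists_tendsto_toDistribution u
    refine tendsto_nhds_unique ((T'.continuous.tendsto u).comp hf) ?_
    refine (((S.precomp ℂ).continuous.tendsto u).comp hf).congr fun n => (heq (f n)).symm
  -- Absorbing `c • F` into the distribution leaves only the kernel operator `N`.
  · obtain ⟨f, hf⟩ := hk.exists_comp_eq_toDistribution (u.comp (c • F)) N hN
    refine ⟨f, ?_⟩
    rw [← hf]
    refine ContinuousLinearMap.ext fun g => ?_
    rfl
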